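/- Let $H$ and $E$ be separable real Hilbert spaces, let $V$ be a Banach space that is compactly and densely embedded in $H$, let $S:H\times E\to V$ be a map, and let $(\eta_k)_{k\ge1}$ be i.i.d. random variables in $E$ with law $\ell$ and $\mathcal K:=\operatorname{supp}\ell$. Consider the random dynamical system $$u_k=S(u_{k-1},\eta_k),\qquad k\ge1,$$ in $H$. Assume: (A1) $S:H\times E\to V$ is twice continuously differentiable, and its derivatives up to second order are bounded on bounded sets. (H1) There are an orthonormal basis $(e_j)$ of $E$, real numbers $b_j\neq0$ with $\sum_j b_j^2<\infty$, and independent real random variables $\xi_{jk}$ with $|\xi_{jk}|\le1$ a.s. such that $\eta_k=\sum_j b_j\xi_{jk}e_j$; the law of $\xi_{jk}$ is $\rho_j(r)\,dr$, where $\rho_j:\mathbb R\to\mathbb R$ is Lipschitz and $\rho_j(0)\ne0$. (H2) For some $0<\gamma<1$ and $\beta>0$: $\|S(u,\eta)\|_H\le\gamma\|u\|_H+\beta$ and $\|S(u,0)\|_H\le\gamma\|u\|_H$ for all $u\in H$, $\eta\in\mathcal K$. (H3) For all $u\in H$ and $\eta\in\mathcal K$ the image of $D_\eta S(u,\eta):E\to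 V$ is dense in $H$. For a Borel probability measure $\mu$ on $H$ let $\mathcal P_k^*\mu$ be the law of $u_k$ when $u_0$ has law $\mu$ and is independent of $(\eta_k)_{k\ge1}$. Let $\|\mu-\nu\|_L^*$ be the supremum of $|\int f\,d\mu-\int f\,d\nu|$ over all $f:H\to\mathbb R$ with $\sup|f|\le1$ and $\operatorname{Lip}(f)\le1$, and let $B_H(R)$ be the closed $R$-ball of $H$ centred at $0$. Then: 1. The system defines a Markov chain in $H$: whenever $u_0$ is independent of the noise, $(u_k)_{k\ge 0}$ is a time-homogeneous Markov chain whose transition probability $P_k(u,\cdot)$ after $k$ steps is the law of $u_k$ started at $u_0=u$. It has a unique stationary probability measure $\mu_*$. 2. $\mu_*$ is supported by $B_H(R_*^0)$, where $R_*^0:=\beta/(1-\gamma)$. 3. For every $R_*\ge R_*^0$ there are $C>0$ and $\kappa\in(0,1)$, depending on $R_*$ but not on $\mu$, such that for every Borel probability measure $\mu$ supported by $B_H(R_*)$ $$\|\mathcal P_k^*\mu-\mu_*\|_L^*\le C\kappa^k\qquad\forall\,k\ge1.$$ 4. For every Borel probability measure $\nu$ on $H$, $\mathcal P_k^*\nu$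 converges weakly to $\mu_*$ as $k\to\infty$. -/

import Mathlib

open MeasureTheory ProbabilityTheory Filter Topology

noncomputable section

namespace RDS

/-- `V` is compactly and densely embedded in `H`, the embedding being `emb`. -/
structure IsCompactDenseEmbedding {V H : Type*} [NormedAddCommGroup V] [NormedSpace ℝ V]
    [NormedAddCommGroup H] [NormedSpace ℝ H] (emb : V →L[ℝ] H) : Prop where
  injective : Function.Injective emb
  compact : IsCompactOperator emb
  dense : DenseRange emb

/-- (A1): `S : H × E → V` is `C²` and its derivatives of first and second order are bounded on
bounded sets (so that `S` itself is bounded on bounded sets as well). -/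
structure Regular {H E V : Type*} [NormedAddCommGroup H] [NormedSpace ℝ H]
    [NormedAddCommGroup E] [NormedSpace ℝ E] [NormedAddCommGroup V] [NormedSpace ℝ V]
    (S : H × E → V) : Prop where
  contDiff : ContDiff ℝ 2 S
  bounded : ∀ B : Set (H × E), Bornology.IsBounded B →
    ∃ C : ℝ, ∀ z ∈ B, ‖fderiv ℝ S z‖ ≤ C ∧ ‖fderiv ℝ (fderiv ℝ S) z‖ ≤ C

/-- The random variables `η 0, η 1, …` are i.i.d. with common law `ℓ`. -/
structure IsIIDWithLaw {Ω E : Type*} [MeasurableSpace Ω] [MeasurableSpace E]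
    (Pr : Measure Ω) (η : ℕ → Ω → E) (ℓ : Measure E) : Prop where
  measurable : ∀ k, Measurable (η k)
  indep : iIndepFun η Pr
  law : ∀ k, Pr.map (η k) = ℓ

/-- (H1): `η_k = ∑_j b_j ξ_{jk} e_j` almost surely, where `(e_j)` is an orthonormal basis of `E`,
the `b_j` are nonzero with `∑_j b_j² < ∞`, and the `ξ_{jk}` are independent real random variables,
bounded by `1`, whose law has a Lipschitz density `ρ_j` with `ρ_j(0) ≠ 0`. -/
def Decomposable (ι : Type*) {Ω E : Type*} [MeasurableSpace Ω] [NormedAddCommGroup E]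
    [InnerProductSpace ℝ E] (Pr : Measure Ω) (η : ℕ → Ω → E) : Prop :=
  ∃ (e : HilbertBasis ι ℝ E) (b : ι → ℝ) (ξ : ι → ℕ → Ω → ℝ) (ρ : ι → ℝ → ℝ),
    (∀ k, ∀ᵐ ω ∂Pr, HasSum (fun j => (b j * ξ j k ω) • e j) (η k ω)) ∧
    (∀ j, b j ≠ 0) ∧
    (Summable fun j => b j ^ 2) ∧
    (∀ j k, Measurable (ξ j k)) ∧
    iIndepFun (fun p : ι × ℕ => ξ p.1 p.2) Pr ∧
    (∀ j k, ∀ᵐ ω ∂Pr, |ξ j k ω| ≤ 1) ∧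
    (∀ j r, 0 ≤ ρ j r) ∧
    (∀ j k, Pr.map (ξ j k) = volume.withDensity fun r => ENNReal.ofReal (ρ j r)) ∧
    (∀ j, ∃ L, LipschitzWith L (ρ j)) ∧
    (∀ j, ρ j 0 ≠ 0)

/-- (H2), with constants `γ` and `β`, for the map `F : H × E → H`; `K` is the support of the law of
the noise. -/
structure Dissipative {H E : Type*} [NormedAddCommGroup H] [NormedAddCommGroup E]
    (F : H × E → H) (K : Set E) (γ β : ℝ) : Prop where
  gamma_pos : 0 < γ
  gamma_lt_one : γ < 1
  beta_pos : 0 < β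
  bound : ∀ u : H, ∀ ζ ∈ K, ‖F (u, ζ)‖ ≤ γ * ‖u‖ + β
  bound_zero : ∀ u : H, ‖F (u, 0)‖ ≤ γ * ‖u‖

/-- (H3): for `u ∈ H` and `ζ ∈ K` the image of `D_η S(u, ζ) : E → V` is dense in `H`. -/
def NonDegenerate {H E V : Type*} [NormedAddCommGroup H] [NormedSpace ℝ H]
    [NormedAddCommGroup E] [NormedSpace ℝ E] [NormedAddCommGroup V] [NormedSpace ℝ V]
    (emb : V →L[ℝ] H) (S : H × E → V) (K : Set E) : Prop :=
  ∀ u : H, ∀ ζ ∈ K, DenseRange fun h : E => emb (fderiv ℝ (fun x => S (u, x)) ζ h)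

/-- The trajectory `u_0 = v`, `u_{k+1} = F(u_k, η_k)`: here `η k` is the noise that acts in the
step from time `k` to time `k + 1`. -/
def trajectory {Ω H E : Type*} (F : H × E → H) (η : ℕ → Ω → E) (v : Ω → H) : ℕ → Ω → H
  | 0 => v
  | k + 1 => fun ω => F (trajectory F η v k ω, η k ω)

/-- The transition probability after `k` steps, `P_k(u, ·)`: the law of `u_k` when `u_0 = u`. -/
def transition {Ω H E : Type*} [MeasurableSpace Ω] [MeasurableSpace H]
    (Pr : Measure Ω) (F : H × E → H) (η : ℕ → Ω → E) (k : ℕ) (u : H) : Measure H :=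
  Pr.map (trajectory F η (fun _ => u) k)

/-- `P_k^* μ`: the law of `u_k` when `u_0` has law `μ` and is independent of the noise. It is
realized on `H × Ω` with the measure `μ ⊗ Pr`, with `u_0` the first coordinate. -/
def evolve {Ω H E : Type*} [MeasurableSpace Ω] [MeasurableSpace H]
    (Pr : Measure Ω) (F : H × E → H) (η : ℕ → Ω → E) (k : ℕ) (μ : Measure H) : Measure H :=
  (μ.prod Pr).map (trajectory F (fun j (p : H × Ω) => η j p.2) Prod.fst k)

/-- `u` is a (time-homogeneous) Markov chain whose transition probability after `n` steps is
`P n x A`: for all times `k`, `n` and all measurable `A`,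
`Pr(u_{k+n} ∈ A | u_0, …, u_k) = P_n(u_k, A)` almost surely. -/
structure IsMarkovChain {Ω X : Type*} [MeasurableSpace Ω] [mX : MeasurableSpace X]
    (Pr : Measure Ω) (u : ℕ → Ω → X) (P : ℕ → X → Measure X) : Prop where
  measurable : ∀ k, Measurable (u k)
  measurable_transition : ∀ n, Measurable (P n)
  isProbabilityMeasure : ∀ n x, IsProbabilityMeasure (P n x)
  markov : ∀ (k n : ℕ) (A : Set X), MeasurableSet A →
    Pr[(u (k + n) ⁻¹' A).indicator (fun _ => (1 : ℝ)) |
        ⨆ j : Fin (k + 1), MeasurableSpace.comap (u j) mX]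
      =ᵐ[Pr] fun ω => (P n (u k ω)).real A

/-- The Lipschitz-dual distance `‖μ - ν‖_L^*`: the supremum of `|⟨μ - ν, f⟩|` over all functions
`f` with `sup |f| ≤ 1` and `Lip f ≤ 1`. -/
def lipDualDist {X : Type*} [PseudoMetricSpace X] [MeasurableSpace X] (μ ν : Measure X) : ℝ :=
  sSup {r : ℝ | ∃ f : X → ℝ, (∀ x, |f x| ≤ 1) ∧ LipschitzWith 1 f ∧
    r = |∫ x, f x ∂μ - ∫ x, f x ∂ν|}

/-- `μ` is supported by the closed ball of radius `R` centred at the origin. -/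
def SupportedByBall {H : Type*} [NormedAddCommGroup H] [MeasurableSpace H]
    (μ : Measure H) (R : ℝ) : Prop :=
  μ (Metric.closedBall (0 : H) R)ᶜ = 0

/-- Weak convergence of measures. -/
def WeaklyConverges {X : Type*} [TopologicalSpace X] [MeasurableSpace X]
    (μs : ℕ → Measure X) (μ : Measure X) : Prop :=
  ∀ f : BoundedContinuousFunction X ℝ,
    Tendsto (fun k => ∫ x, f x ∂(μs k)) atTop (𝓝 (∫ x, f x ∂μ))

end RDS

end

/-!
By dissipativity (H2) and compactness of the embedding, everything takes place on one compact set
`X`, invariant under every step with admissible noise. Two mechanisms make the Markov operator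
contract on `X`.

*Small distances.* Density of the image of `D_η S` (H3) and compactness of the embedded derivative
in `u` allow the effect of a small displacement of the starting point to be compensated, up to half
of its size, by a finite-dimensional change of the noise which depends in a Lipschitz way on the
noise itself. Since the noise has Lipschitz densities along the basis, such a change distorts its
law by only `O(displacement)` in total variation. Hence two chains started close together can be
coupled so that their distance contracts with probability close to one.

*Large distances.* The zero noise belongs to the support of the law and contracts towards `0`, so
two chains started anywhere in `X` simultaneously visit a small ball with probability bounded below.

A bounded distance combining both effects is contracted in mean, which gives exponential
convergence in `‖·‖_L^*` on balls; the stationary measure is obtained by compactness, and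
convergence of arbitrary initial laws by integrating that of Dirac masses.
-/

namespace RDS

open scoped ENNReal NNReal RealInnerProductSpace

section AlmostPreserves

/-- `T` moves the measure `ℓ` by at most `ε` in total variation. The inequality is one-sided: for
probability measures the reverse bound follows on replacing `g` by `1 - g`. -/
structure AlmostPreserves {E : Type*} [MeasurableSpace E] (ℓ : Measure E) (T : E → E) (ε : ℝ≥0) :
    Prop where
  measurable : Measurable T
  lintegral_le : ∀ g : E → ℝ≥0∞, Measurable g → (∀ x, g x ≤ 1) →
    ∫⁻ x, g x ∂ℓ ≤ (∫⁻ x, g (T x) ∂ℓ) + ε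

namespace AlmostPreserves

variable {E : Type*} [MeasurableSpace E] {ℓ : Measure E} {T T' : E → E} {ε ε' : ℝ≥0}

theorem id : AlmostPreserves ℓ id 0 := ⟨measurable_id, fun g _ _ => by simp⟩

theorem comp (h : AlmostPreserves ℓ T ε) (h' : AlmostPreserves ℓ T' ε') :
    AlmostPreserves ℓ (T ∘ T') (ε + ε') where
  measurable := h.measurable.comp h'.measurable
  lintegral_le g hg hg1 := calc
    ∫⁻ x, g x ∂ℓ ≤ (∫⁻ x, g (T x) ∂ℓ) + ε := h.lintegral_le g hg hg1
    _ ≤ ((∫⁻ x, g (T (T' x)) ∂ℓ) + ε') + ε := by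
      gcongr
      exact h'.lintegral_le (fun x => g (T x)) (hg.comp h.measurable) fun x => hg1 _
    _ = (∫⁻ x, g ((T ∘ T') x) ∂ℓ) + ((ε + ε' : ℝ≥0) : ℝ≥0∞) := by
      push_cast
      simp only [Function.comp_apply]
      ring

theorem mono (h : AlmostPreserves ℓ T ε) (hε : ε ≤ ε') : AlmostPreserves ℓ T ε' :=
  ⟨h.measurable, fun g hg hg1 => (h.lintegral_le g hg hg1).trans (by gcongr)⟩

theorem map_prod {W S : Type*} [MeasurableSpace W] [MeasurableSpace S] {ν : Measure W}
    [IsProbabilityMeasure ν] {σ : Measure S} [SFinite σ] {Φ : W × S → E} (hΦ : Measurable Φ)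
    (hT : Measurable T) {τ : W → S → S} (hτ : ∀ w, AlmostPreserves σ (τ w) ε)
    (hTΦ : ∀ w s, T (Φ (w, s)) = Φ (w, τ w s)) : AlmostPreserves ((ν.prod σ).map Φ) T ε where
  measurable := hT
  lintegral_le g hg hg1 := by
    have hgT : Measurable fun x => g (T x) := hg.comp hT
    rw [lintegral_map hg hΦ, lintegral_map hgT hΦ,
      lintegral_prod (fun p => g (Φ p)) (hg.comp hΦ).aemeasurable,
      lintegral_prod (fun p => g (T (Φ p))) (hgT.comp hΦ).aemeasurable]
    calc ∫⁻ w, ∫⁻ s, g (Φ (w, s)) ∂σ ∂ν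
        ≤ ∫⁻ w, ((∫⁻ s, g (T (Φ (w, s))) ∂σ) + ε) ∂ν := by
          refine lintegral_mono fun w => ?_
          simp only [hTΦ]
          exact (hτ w).lintegral_le _ (hg.comp (hΦ.comp measurable_prodMk_left)) fun s => hg1 _
      _ = (∫⁻ w, ∫⁻ s, g (T (Φ (w, s))) ∂σ ∂ν) + ε := by
          rw [lintegral_add_right _ measurable_const, lintegral_const, measure_univ, mul_one]

variable [IsProbabilityMeasure ℓ]

theorem of_one_le (hT : Measurable T) (hε : 1 ≤ ε) : AlmostPreserves ℓ T ε where
  measurable := hT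
  lintegral_le g _ hg1 := calc
    ∫⁻ x, g x ∂ℓ ≤ ∫⁻ _, 1 ∂ℓ := lintegral_mono hg1
    _ ≤ ε := by simpa using hε
    _ ≤ (∫⁻ x, g (T x) ∂ℓ) + ε := le_add_self

theorem integral_le_of_mem_Icc (h : AlmostPreserves ℓ T ε) {f : E → ℝ} (hf : Measurable f)
    (hf1 : ∀ x, f x ∈ Set.Icc (0 : ℝ) 1) : ∫ x, f x ∂ℓ ≤ (∫ x, f (T x) ∂ℓ) + ε := by
  have integrable_of_mem_Icc : ∀ {g : E → ℝ}, Measurable g → (∀ x, g x ∈ Set.Icc (0 : ℝ) 1) →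
      Integrable g ℓ := fun hg hg1 =>
    Integrable.of_bound hg.aestronglyMeasurable 1 (.of_forall fun x => by
      rw [Real.norm_eq_abs, abs_of_nonneg (hg1 x).1]
      exact (hg1 x).2)
  have hlintegral := h.lintegral_le (fun x => ENNReal.ofReal (f x)) hf.ennreal_ofReal
    fun x => by simpa using (hf1 x).2
  have hpos : 0 ≤ ∫ x, f (T x) ∂ℓ := integral_nonneg fun x => (hf1 _).1
  rw [← ofReal_integral_eq_lintegral_ofReal (integrable_of_mem_Icc hf hf1)
      (.of_forall fun x => (hf1 x).1),
    ← ofReal_integral_eq_lintegral_ofReal (f := fun x => f (T x))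
      (integrable_of_mem_Icc (hf.comp h.measurable) fun x => hf1 _) (.of_forall fun x => (hf1 _).1),
    ← ENNReal.ofReal_coe_nnreal, ← ENNReal.ofReal_add hpos ε.coe_nonneg] at hlintegral
  exact (ENNReal.ofReal_le_ofReal_iff (add_nonneg hpos ε.coe_nonneg)).1 hlintegral

theorem integral_le (h : AlmostPreserves ℓ T ε) {f : E → ℝ} (hf : Measurable f) {a : ℝ}
    (hfa : ∀ x, |f x| ≤ a) : ∫ x, f x ∂ℓ ≤ (∫ x, f (T x) ∂ℓ) + 2 * a * ε := by
  obtain ⟨x₀⟩ : Nonempty E := nonempty_of_isProbabilityMeasure ℓ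
  rcases ((abs_nonneg (f x₀)).trans (hfa x₀)).eq_or_lt with rfl | ha
  · simp [fun x => abs_nonpos_iff.1 (hfa x)]
  have integrable_of_abs_le : ∀ {g : E → ℝ}, Measurable g → (∀ x, |g x| ≤ a) → Integrable g ℓ :=
    fun hg hga => Integrable.of_bound hg.aestronglyMeasurable a (.of_forall hga)
  have hscaled := h.integral_le_of_mem_Icc (f := fun x => (f x + a) / (2 * a))
    ((hf.add_const a).div_const _) fun x =>
      ⟨div_nonneg (by linarith [(abs_le.1 (hfa x)).1]) (by linarith),
        (div_le_one (by linarith)).2 (by linarith [(abs_le.1 (hfa x)).2])⟩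
  rw [integral_div, integral_div, integral_add (integrable_of_abs_le hf hfa) (integrable_const _),
    integral_add (f := fun x => f (T x))
      (integrable_of_abs_le (hf.comp h.measurable) fun x => hfa _) (integrable_const _),
    div_le_iff₀ (by linarith), add_mul, div_mul_cancel₀ _ (by linarith)] at hscaled
  linarith

theorem abs_integral_sub_le (h : AlmostPreserves ℓ T ε) {f : E → ℝ} (hf : Measurable f) {a : ℝ}
    (hfa : ∀ x, |f x| ≤ a) : |∫ x, f x ∂ℓ - ∫ x, f (T x) ∂ℓ| ≤ 2 * a * ε := by
  have hle := h.integral_le hf hfa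
  have hge := h.integral_le hf.neg (a := a) fun x => by simpa using hfa x
  simp only [Pi.neg_apply, integral_neg] at hge
  exact abs_le.2 ⟨by linarith, by linarith⟩

theorem measureReal_le (h : AlmostPreserves ℓ T ε) {A : Set E} (hA : MeasurableSet A) :
    ℓ.real A ≤ ℓ.real (T ⁻¹' A) + ε := by
  have hle := h.integral_le_of_mem_Icc (f := A.indicator fun _ => (1 : ℝ))
    (measurable_const.indicator hA) fun x => by
      by_cases hx : x ∈ A <;> simp [hx]
  have hpreimage : (fun x => A.indicator (fun _ => (1 : ℝ)) (T x)) =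
      (T ⁻¹' A).indicator fun _ => (1 : ℝ) := rfl
  rwa [hpreimage, integral_indicator_const _ hA, integral_indicator_const _ (h.measurable hA),
    smul_eq_mul, smul_eq_mul, mul_one, mul_one] at hle

end AlmostPreserves

end AlmostPreserves

section ShearStable

/-- Shears in the direction `v` move `ℓ` in total variation by at most a constant times their
`C^{0,1}` size. This is the quantitative smoothness of the noise along `v`. -/
def ShearStable {E : Type*} [NormedAddCommGroup E] [NormedSpace ℝ E] [MeasurableSpace E]
    (ℓ : Measure E) (v : E) : Prop :=
  ∃ C : ℝ≥0, ∀ (M : ℝ≥0) (c : E → ℝ), LipschitzWith M c → (∀ x, |c x| ≤ M) →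
    AlmostPreserves ℓ (fun x => x + c x • v) (C * M)

theorem surjective_add_of_abs_le {c : ℝ → ℝ} (hc : Continuous c) {B : ℝ} (hB : ∀ r, |c r| ≤ B) :
    Function.Surjective fun r => r + c r :=
  (continuous_id.add hc).surjective
    (tendsto_atTop_add_right_of_le _ (-B) tendsto_id fun r => (abs_le.1 (hB r)).1)
    (tendsto_atBot_add_right_of_ge _ B tendsto_id fun r => (abs_le.1 (hB r)).2)

theorem volume_le_smul_map_add {c : ℝ → ℝ} {M : ℝ≥0} (hc : LipschitzWith M c) {B : ℝ}
    (hB : ∀ r, |c r| ≤ B) :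
    (volume : Measure ℝ) ≤ ((1 + M : ℝ≥0) : ℝ≥0∞) • (volume : Measure ℝ).map fun r => r + c r := by
  have hlip : LipschitzWith (1 + M) fun r => r + c r := LipschitzWith.id.add hc
  refine Measure.le_iff.2 fun A hA => ?_
  rw [Measure.smul_apply, Measure.map_apply hlip.continuous.measurable hA, smul_eq_mul]
  conv_lhs => rw [← Set.image_preimage_eq A (surjective_add_of_abs_le hc.continuous hB)]
  simpa [hausdorffMeasure_real] using
    hlip.hausdorffMeasure_image_le (d := 1) zero_le_one ((fun r => r + c r) ⁻¹' A)

theorem lintegral_le_mul_lintegral_comp_add {c : ℝ → ℝ} {M : ℝ≥0} (hc : LipschitzWith M c) {B : ℝ}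
    (hB : ∀ r, |c r| ≤ B) {f : ℝ → ℝ≥0∞} (hf : Measurable f) :
    ∫⁻ r, f r ≤ ((1 + M : ℝ≥0) : ℝ≥0∞) * ∫⁻ r, f (r + c r) := by
  have hTm : Measurable fun r => r + c r := measurable_id.add hc.continuous.measurable
  rw [← lintegral_map hf hTm, ← smul_eq_mul, ← lintegral_smul_measure]
  exact lintegral_mono' (volume_le_smul_map_add hc hB) le_rfl

theorem ofReal_comp_add_le {ρ : ℝ → ℝ} {L : ℝ≥0} (hρ : LipschitzWith L ρ) {t : ℝ} {M : ℝ≥0}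
    (ht : |t| ≤ M) (r : ℝ) :
    ENNReal.ofReal (ρ (r + t)) ≤ ENNReal.ofReal (ρ r) + ((L * M : ℝ≥0) : ℝ≥0∞) := by
  have hdist : |ρ (r + t) - ρ r| ≤ L * |t| := by
    simpa [Real.dist_eq] using hρ.dist_le_mul (r + t) r
  have hreal : ρ (r + t) ≤ ρ r + (L * M : ℝ≥0) := by
    push_cast
    linarith [le_abs_self (ρ (r + t) - ρ r), mul_le_mul_of_nonneg_left ht L.coe_nonneg]
  calc ENNReal.ofReal (ρ (r + t)) ≤ ENNReal.ofReal (ρ r + (L * M : ℝ≥0)) :=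
        ENNReal.ofReal_le_ofReal hreal
    _ ≤ _ := ENNReal.ofReal_add_le.trans_eq (by rw [ENNReal.ofReal_coe_nnreal])

theorem lintegral_indicator_mul_comp_add_le {ρ : ℝ → ℝ} {L : ℝ≥0} (hρ : LipschitzWith L ρ) {R : ℝ}
    {c : ℝ → ℝ} {M : ℝ≥0} (hc : ∀ r, |c r| ≤ M) {g : ℝ → ℝ≥0∞} (hg : ∀ r, g r ≤ 1) :
    ∫⁻ r, (Set.Icc (-R) R).indicator (fun r => g r * ENNReal.ofReal (ρ r)) (r + c r) ≤
      (∫⁻ r, g (r + c r) * ENNReal.ofReal (ρ r)) +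
        ((L * M : ℝ≥0) : ℝ≥0∞) * ENNReal.ofReal (2 * (R + M)) := by
  have hpointwise : ∀ r, (Set.Icc (-R) R).indicator (fun r => g r * ENNReal.ofReal (ρ r)) (r + c r)
      ≤ g (r + c r) * ENNReal.ofReal (ρ r) +
        (Set.Icc (-(R + M)) (R + M)).indicator (fun _ => ((L * M : ℝ≥0) : ℝ≥0∞)) r := by
    intro r
    by_cases hr : r + c r ∈ Set.Icc (-R) R
    swap
    · simp only [Set.indicator_of_notMem hr, zero_le]
    have hr' : r ∈ Set.Icc (-(R + M)) (R + M) := by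
      have := abs_le.1 (hc r)
      exact ⟨by linarith [hr.1], by linarith [hr.2]⟩
    rw [Set.indicator_of_mem hr, Set.indicator_of_mem hr']
    calc g (r + c r) * ENNReal.ofReal (ρ (r + c r))
        ≤ g (r + c r) * (ENNReal.ofReal (ρ r) + ((L * M : ℝ≥0) : ℝ≥0∞)) := by
          gcongr
          exact ofReal_comp_add_le hρ (hc r) r
      _ ≤ g (r + c r) * ENNReal.ofReal (ρ r) + ((L * M : ℝ≥0) : ℝ≥0∞) := by
          rw [mul_add]
          gcongr
          exact mul_le_of_le_one_left zero_le (hg _)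
  refine (lintegral_mono hpointwise).trans_eq ?_
  rw [lintegral_add_right _ (measurable_const.indicator measurableSet_Icc),
    lintegral_indicator measurableSet_Icc, setLIntegral_const, Real.volume_Icc]
  congr 3
  ring

theorem lintegral_withDensity_ofReal {ρ : ℝ → ℝ} (hρ : Measurable ρ) {g : ℝ → ℝ≥0∞}
    (hg : Measurable g) : ∫⁻ r, g r ∂volume.withDensity (fun r => ENNReal.ofReal (ρ r)) =
      ∫⁻ r, g r * ENNReal.ofReal (ρ r) := by
  simpa only [Pi.mul_apply, mul_comm] using
    lintegral_withDensity_eq_lintegral_mul _ hρ.ennreal_ofReal hg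

theorem lintegral_withDensity_ofReal_eq_lintegral_indicator {ρ : ℝ → ℝ} (hρ : Measurable ρ) {R : ℝ}
    (hR : ∀ᵐ r ∂volume.withDensity fun r => ENNReal.ofReal (ρ r), |r| ≤ R) {g : ℝ → ℝ≥0∞}
    (hg : Measurable g) : ∫⁻ r, g r ∂volume.withDensity (fun r => ENNReal.ofReal (ρ r)) =
      ∫⁻ r, (Set.Icc (-R) R).indicator (fun r => g r * ENNReal.ofReal (ρ r)) r := by
  rw [lintegral_withDensity_ofReal hρ hg]
  refine lintegral_congr_ae ?_
  filter_upwards [(ae_withDensity_iff hρ.ennreal_ofReal).1 hR] with r hr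
  by_cases h0 : ENNReal.ofReal (ρ r) = 0
  · simp [h0, Set.indicator]
  · rw [Set.indicator_of_mem (Set.mem_Icc.2 (abs_le.1 (hr h0)))]

-- `|r| ≤ R` on the support and a shift by at most `1` confine everything to `[-(R + 1), R + 1]`,
-- where the density changes by at most `L M`; the map `r ↦ r + c r` stretches Lebesgue measure by a
-- factor of at most `1 + M`.
theorem shearStable_withDensity_of_lipschitz {ρ : ℝ → ℝ} {L : ℝ≥0} (hρ : LipschitzWith L ρ) {R : ℝ}
    [IsProbabilityMeasure (volume.withDensity fun r => ENNReal.ofReal (ρ r))]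
    (hR : ∀ᵐ r ∂volume.withDensity fun r => ENNReal.ofReal (ρ r), |r| ≤ R) :
    ShearStable (volume.withDensity fun r => ENNReal.ofReal (ρ r)) 1 := by
  have hρm : Measurable ρ := hρ.continuous.measurable
  set σ := volume.withDensity fun r => ENNReal.ofReal (ρ r)
  set K : ℝ≥0 := L * Real.toNNReal (2 * (R + 1)) with hK
  refine ⟨1 + 2 * K, fun M c hc hcM => ?_⟩
  have hTm : Measurable fun r => r + c r := measurable_id.add hc.continuous.measurable
  simp only [smul_eq_mul, mul_one]
  rcases lt_or_ge 1 M with hM | hM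
  · exact AlmostPreserves.of_one_le hTm (hM.le.trans (le_mul_of_one_le_left zero_le le_self_add))
  refine ⟨hTm, fun g hg hg1 => ?_⟩
  set A := ∫⁻ r, g (r + c r) ∂σ
  have hA1 : A ≤ 1 := (lintegral_mono fun r => hg1 _).trans_eq (by simp)
  have hA_eq : A = ∫⁻ r, g (r + c r) * ENNReal.ofReal (ρ r) :=
    lintegral_withDensity_ofReal (g := fun r => g (r + c r)) hρm (hg.comp hTm)
  calc ∫⁻ r, g r ∂σ
      ≤ ((1 + M : ℝ≥0) : ℝ≥0∞) *
          ∫⁻ r, (Set.Icc (-R) R).indicator (fun r => g r * ENNReal.ofReal (ρ r)) (r + c r) :=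
        (lintegral_withDensity_ofReal_eq_lintegral_indicator hρm hR hg).trans_le
          (lintegral_le_mul_lintegral_comp_add hc hcM
            ((hg.mul hρm.ennreal_ofReal).indicator measurableSet_Icc))
    _ ≤ ((1 + M : ℝ≥0) : ℝ≥0∞) *
          (A + ((L * M : ℝ≥0) : ℝ≥0∞) * ENNReal.ofReal (2 * (R + 1))) := by
        gcongr
        refine (lintegral_indicator_mul_comp_add_le hρ hcM hg1).trans ?_
        rw [hA_eq]
        gcongr
        exact_mod_cast hM
    _ = A + (M * A + (((1 + M) * K * M : ℝ≥0) : ℝ≥0∞)) := by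
        rw [hK, ENNReal.ofReal]
        push_cast
        ring
    _ ≤ A + (M * 1 + ((2 * K * M : ℝ≥0) : ℝ≥0∞)) := by
        have : 1 + M ≤ 2 := by rw [← one_add_one_eq_two]; gcongr
        gcongr
    _ = A + ((1 + 2 * K) * M : ℝ≥0) := by
        push_cast
        ring

theorem ShearStable.map_prod_add_smul {E : Type*} [NormedAddCommGroup E] [NormedSpace ℝ E]
    [MeasurableSpace E] [BorelSpace E] [SecondCountableTopology E] {ν : Measure E}
    [IsProbabilityMeasure ν] {σ : Measure ℝ} [SFinite σ] (hσ : ShearStable σ 1) {b : ℝ}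
    (hb : b ≠ 0) (v : E) : ShearStable ((ν.prod σ).map fun p => p.1 + p.2 • b • v) v := by
  obtain ⟨C, hC⟩ := hσ
  set κ : ℝ≥0 := max ‖v‖₊ ‖b‖₊⁻¹
  refine ⟨C * κ, fun M c hc hcM => ?_⟩
  -- Along the line `w + ℝ v` the shear of `E` is a shear of the real parameter.
  let d : E → ℝ → ℝ := fun w r => c (w + r • b • v) / b
  have hd_lip : ∀ w, LipschitzWith (κ * M) (d w) := fun w =>
    LipschitzWith.of_dist_le_mul fun r s => by
      have hcdist := hc.dist_le_mul (w + r • b • v) (w + s • b • v)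
      rw [dist_add_left, dist_eq_norm, dist_eq_norm, ← sub_smul, norm_smul, norm_smul] at hcdist
      rw [dist_eq_norm, ← sub_div, norm_div, div_le_iff₀ (norm_pos_iff.2 hb), dist_eq_norm]
      calc ‖c (w + r • b • v) - c (w + s • b • v)‖ ≤ M * (‖r - s‖ * (‖b‖ * ‖v‖)) := hcdist
        _ = ‖v‖ * M * ‖r - s‖ * ‖b‖ := by ring
        _ ≤ (κ * M : ℝ≥0) * ‖r - s‖ * ‖b‖ := by
          push_cast
          gcongr
          exact_mod_cast le_max_left ‖v‖₊ ‖b‖₊⁻¹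
  have hd_le : ∀ w r, |d w r| ≤ (κ * M : ℝ≥0) := fun w r => by
    have hbκ : ‖b‖⁻¹ ≤ (κ : ℝ) := by exact_mod_cast le_max_right ‖v‖₊ ‖b‖₊⁻¹
    rw [abs_div, div_eq_mul_inv, mul_comm, NNReal.coe_mul]
    exact mul_le_mul hbκ (hcM _) (abs_nonneg _) κ.coe_nonneg
  have hcm : Measurable c := hc.continuous.measurable
  rw [mul_assoc]
  refine AlmostPreserves.map_prod (τ := fun w r => r + d w r) (by fun_prop) (by fun_prop)
    (fun w => by simpa using hC (κ * M) (d w) (hd_lip w) (hd_le w)) fun w r => ?_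
  simp only [d, add_smul, smul_smul (_ / b), div_mul_cancel₀ _ hb, add_assoc]

-- `Ψ` is the composition of the shears along the individual `e j`.
theorem exists_almostPreserves_of_shearStable {ι E : Type*} [NormedAddCommGroup E]
    [NormedSpace ℝ E] [MeasurableSpace E] {ℓ : Measure E} {e : ι → E} (he : ∀ j, ‖e j‖ ≤ 1)
    (hs : ∀ j, ShearStable ℓ (e j)) (J : Finset ι) :
    ∃ C : ℝ≥0, ∀ (M : ℝ≥0) (c : ι → E → ℝ), (∀ j, LipschitzWith M (c j)) →
      (∀ j x, |c j x| ≤ M) → ∃ Ψ : E → E, AlmostPreserves ℓ Ψ (C * M) ∧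
        ∀ x, ‖Ψ x - x‖ ≤ J.card * M ∧
          ‖Ψ x - x - ∑ j ∈ J, c j x • e j‖ ≤ (J.card : ℝ) ^ 2 * (M : ℝ) ^ 2 := by
  classical
  induction J using Finset.induction_on with
  | empty => exact ⟨0, fun M c _ _ => ⟨id, AlmostPreserves.id.mono zero_le, fun x => by simp⟩⟩
  | insert i J hi ih =>
    obtain ⟨C, hC⟩ := ih
    obtain ⟨C', hC'⟩ := hs i
    refine ⟨C' + C, fun M c hc hM => ?_⟩
    obtain ⟨Ψ, hΨ, hΨx⟩ := hC M c hc hM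
    refine ⟨_, ((hC' M (c i) (hc i) (hM i)).comp hΨ).mono (by rw [add_mul]), fun x => ?_⟩
    obtain ⟨hdisp, herr⟩ := hΨx x
    have hstep : ‖c i (Ψ x) • e i‖ ≤ M := by
      rw [norm_smul]
      exact (mul_le_of_le_one_right (norm_nonneg _) (he i)).trans (hM i _)
    have hshift : ‖c i (Ψ x) • e i - c i x • e i‖ ≤ M * (J.card * M) := by
      rw [← sub_smul, norm_smul, ← dist_eq_norm]
      calc dist (c i (Ψ x)) (c i x) * ‖e i‖ ≤ dist (c i (Ψ x)) (c i x) :=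
            mul_le_of_le_one_right dist_nonneg (he i)
        _ ≤ M * ‖Ψ x - x‖ := dist_eq_norm (Ψ x) x ▸ (hc i).dist_le_mul _ _
        _ ≤ M * (J.card * M) := by gcongr
    rw [Finset.sum_insert hi, Finset.card_insert_of_notMem hi]
    simp only [Function.comp_apply]
    push_cast
    constructor
    · calc ‖Ψ x + c i (Ψ x) • e i - x‖ = ‖(Ψ x - x) + c i (Ψ x) • e i‖ := by congr 1; abel
        _ ≤ J.card * M + M := norm_add_le_of_le hdisp hstep
        _ = (J.card + 1) * M := by ring
    · calc ‖Ψ x + c i (Ψ x) • e i - x - (c i x • e i + ∑ j ∈ J, c j x • e j)‖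
          = ‖(Ψ x - x - ∑ j ∈ J, c j x • e j) + (c i (Ψ x) • e i - c i x • e i)‖ := by
            congr 1; abel
        _ ≤ (J.card : ℝ) ^ 2 * (M : ℝ) ^ 2 + M * (J.card * M) := norm_add_le_of_le herr hshift
        _ ≤ (J.card + 1 : ℝ) ^ 2 * (M : ℝ) ^ 2 := by
          nlinarith [show (0 : ℝ) ≤ (M : ℝ) ^ 2 * (J.card + 1) by positivity]

end ShearStable

section Independence

theorem comap_subfamily_le {ι α Ω E : Type*} [MeasurableSpace E] (X : ι → Ω → E) (f : α → ι) :
    MeasurableSpace.comap (fun ω a => X (f a) ω) MeasurableSpace.pi ≤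
      ⨆ i ∈ Set.range f, MeasurableSpace.comap (X i) inferInstance := by
  simp only [MeasurableSpace.pi, MeasurableSpace.comap_iSup, MeasurableSpace.comap_comp]
  exact iSup_le fun a => le_iSup₂_of_le (f := fun i (_ : i ∈ Set.range f) =>
    MeasurableSpace.comap (X i) inferInstance) (f a) ⟨a, rfl⟩ le_rfl

variable {Ω : Type*} [MeasurableSpace Ω] {Pr : Measure Ω}

theorem indepFun_subfamilies {ι α β E : Type*} [MeasurableSpace E] {X : ι → Ω → E}
    (hX : ∀ i, Measurable (X i)) (hind : iIndepFun X Pr) {f : α → ι} {g : β → ι}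
    (hfg : Disjoint (Set.range f) (Set.range g)) :
    IndepFun (fun ω a => X (f a) ω) (fun ω b => X (g b) ω) Pr := by
  rw [IndepFun_iff_Indep]
  exact indep_of_indep_of_le_left (indep_of_indep_of_le_right
    (indep_iSup_of_disjoint (fun i => (hX i).comap_le) hind hfg) (comap_subfamily_le X g))
    (comap_subfamily_le X f)

-- The remaining terms converge almost surely to a measurable function of their coefficients, hence
-- to a random variable that is independent of `ξ j`.
theorem exists_map_eq_map_prod_add_smul {ι E : Type*} [IsProbabilityMeasure Pr] [Countable ι]
    [NormedAddCommGroup E] [NormedSpace ℝ E] [CompleteSpace E]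
    [SecondCountableTopology E] [MeasurableSpace E] [BorelSpace E] {a : ι → E} {ξ : ι → Ω → ℝ}
    {X : Ω → E} (hsum : ∀ᵐ ω ∂Pr, HasSum (fun j => ξ j ω • a j) (X ω))
    (hξ : ∀ j, Measurable (ξ j)) (hind : iIndepFun ξ Pr) (j : ι) :
    ∃ ν : Measure E, IsProbabilityMeasure ν ∧
      Pr.map X = (ν.prod (Pr.map (ξ j))).map fun p => p.1 + p.2 • a j := by
  classical
  let others := {i // i ∉ ({j} : Finset ι)}
  let φ : (others → ℝ) → E := fun t => limUnder atTop fun s : Finset others => ∑ i ∈ s, t i • a i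
  have hφ : Measurable φ := (StronglyMeasurable.limUnder (l := atTop)
    fun s : Finset others => Finset.stronglyMeasurable_fun_sum s fun i _ =>
      (measurable_pi_apply i).stronglyMeasurable.smul_const (a i)).measurable
  let Y : Ω → E := fun ω => φ fun i => ξ i ω
  have hY : Measurable Y := hφ.comp (measurable_pi_lambda _ fun i => hξ i)
  have hX : X =ᵐ[Pr] fun ω => Y ω + ξ j ω • a j := by
    filter_upwards [hsum] with ω hω
    have hothers : HasSum (fun i : others => ξ i ω • a i) (X ω - ξ j ω • a j) := by
      rw [Finset.hasSum_compl_iff (f := fun i => ξ i ω • a i)]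
      simpa using hω
    rw [show Y ω = X ω - ξ j ω • a j from Tendsto.limUnder_eq hothers, sub_add_cancel]
  have hYξ : IndepFun Y (ξ j) Pr := by
    refine (indepFun_subfamilies hξ hind (f := fun i : others => (i : ι)) (g := fun _ : Unit => j)
      (Set.disjoint_left.2 ?_)).comp hφ (ψ := fun t : Unit → ℝ => t ())
        (measurable_pi_apply ())
    rintro _ ⟨i, rfl⟩ ⟨_, hi⟩
    exact i.2 (by simp [← hi])
  refine ⟨Pr.map Y, Measure.isProbabilityMeasure_map hY.aemeasurable, ?_⟩
  rw [← (indepFun_iff_map_prod_eq_prod_map_map hY.aemeasurable (hξ j).aemeasurable).1 hYξ,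
    Measure.map_map (by fun_prop) (by fun_prop)]
  exact Measure.map_congr hX

end Independence

section Cube

variable {ι E : Type*} [NormedAddCommGroup E] [InnerProductSpace ℝ E]

/-- The Hilbert cube whose `j`-th side is `[-|b j|, |b j|]`; it carries the law of the noise. -/
def cube (e : HilbertBasis ι ℝ E) (b : ι → ℝ) : Set E := {x | ∀ j, |⟪e j, x⟫| ≤ |b j|}

theorem isClosed_cube (e : HilbertBasis ι ℝ E) (b : ι → ℝ) : IsClosed (cube e b) := by
  simp only [cube, Set.ofPred_forall]
  exact isClosed_iInter fun j => isClosed_le (by fun_prop) continuous_const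

theorem inner_eq_of_hasSum (e : HilbertBasis ι ℝ E) {t : ι → ℝ} {x : E}
    (hx : HasSum (fun j => t j • e j) x) (i : ι) : ⟪e i, x⟫ = t i := by
  classical
  have hinner := (innerSL ℝ (e i)).hasSum hx
  simp only [innerSL_apply_apply, inner_smul_right,
    orthonormal_iff_ite.1 e.orthonormal, mul_ite, mul_one, mul_zero] at hinner
  exact hinner.unique (by
    simpa using hasSum_single (f := fun j => if i = j then t j else 0) i
      fun j hj => if_neg hj.symm)

theorem norm_sq_le_sum_add_tsum (e : HilbertBasis ι ℝ E) {b : ι → ℝ}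
    (hb : Summable fun j => b j ^ 2) (J : Finset ι) {y : E}
    (hy : ∀ j ∉ J, ⟪e j, y⟫ ^ 2 ≤ b j ^ 2) :
    ‖y‖ ^ 2 ≤ ∑ j ∈ J, ⟪e j, y⟫ ^ 2 + ∑' j : {j // j ∉ J}, b j ^ 2 := by
  have parseval : HasSum (fun j => ⟪e j, y⟫ ^ 2) (‖y‖ ^ 2) := by
    simpa only [real_inner_self_eq_norm_sq, real_inner_comm, sq] using e.hasSum_inner_mul_inner y y
  rw [← parseval.tsum_eq, ← parseval.summable.sum_add_tsum_subtype_compl J]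
  exact add_le_add_right ((parseval.summable.subtype _).tsum_le_tsum
    (fun j : {j // j ∉ J} => hy j j.2) (hb.subtype _)) _

theorem exists_finset_norm_lt_of_mem_cube (e : HilbertBasis ι ℝ E) {b : ι → ℝ}
    (hb : Summable fun j => b j ^ 2) {ε : ℝ} (hε : 0 < ε) :
    ∃ (J : Finset ι) (s : ℝ), 0 < s ∧
      ∀ y ∈ cube e b, (∀ j ∈ J, |⟪e j, y⟫| ≤ s * |b j|) → ‖y‖ < ε := by
  obtain ⟨J, hJ⟩ := ((tendsto_order.1 (tendsto_tsum_compl_atTop_zero fun j => b j ^ 2)).2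
    (ε ^ 2 / 2) (by positivity)).exists
  have hhead : Tendsto (fun s : ℝ => s ^ 2 * ∑ j ∈ J, b j ^ 2) (𝓝[>] 0) (𝓝 0) :=
    tendsto_nhdsWithin_of_tendsto_nhds <|
      (by fun_prop : Continuous fun s : ℝ => s ^ 2 * ∑ j ∈ J, b j ^ 2).tendsto' 0 0 (by simp)
  obtain ⟨s, hs, hs0⟩ := (((tendsto_order.1 hhead).2 (ε ^ 2 / 2) (by positivity)).and
    self_mem_nhdsWithin).exists
  refine ⟨J, s, hs0, fun y hy hyJ => lt_of_pow_lt_pow_left₀ 2 hε.le ?_⟩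
  calc ‖y‖ ^ 2 ≤ ∑ j ∈ J, ⟪e j, y⟫ ^ 2 + ∑' j : {j // j ∉ J}, b j ^ 2 :=
        norm_sq_le_sum_add_tsum e hb J fun j _ => sq_le_sq.2 (hy j)
    _ ≤ ∑ j ∈ J, s ^ 2 * b j ^ 2 + ∑' j : {j // j ∉ J}, b j ^ 2 := by
        gcongr with j hj
        rw [← sq_abs ⟪e j, y⟫, ← sq_abs (b j), ← mul_pow]
        exact pow_le_pow_left₀ (abs_nonneg _) (hyJ j hj) 2
    _ < ε ^ 2 := by
        rw [← Finset.mul_sum]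
        linarith

theorem isCompact_cube (e : HilbertBasis ι ℝ E) {b : ι → ℝ} (hb : Summable fun j => b j ^ 2) :
    IsCompact (cube e b) := by
  classical
  have : CompleteSpace E := e.repr.toIsometryEquiv.completeSpace
  refine isCompact_iff_totallyBounded_isComplete.2
    ⟨Metric.totallyBounded_iff.2 fun ε hε => ?_, (isClosed_cube e b).isComplete⟩
  obtain ⟨J, s, hs, hJ⟩ := exists_finset_norm_lt_of_mem_cube e hb (half_pos hε)
  have hface : IsCompact ((fun t : ι → ℝ => ∑ j ∈ J, t j • e j) ''
      Set.pi Set.univ fun j => Set.Icc (-|b j|) |b j|) :=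
    (isCompact_univ_pi fun j => isCompact_Icc).image (by fun_prop)
  obtain ⟨t, ht, hcover⟩ := Metric.totallyBounded_iff.1 hface.totallyBounded (ε / 2) (half_pos hε)
  refine ⟨t, ht, fun x hx => ?_⟩
  set z := ∑ j ∈ J, ⟪e j, x⟫ • e j with hz
  obtain ⟨y, hy, hzy⟩ := Set.mem_iUnion₂.1 <|
    hcover ⟨fun j => ⟪e j, x⟫, fun j _ => abs_le.1 (hx j), hz.symm⟩
  have hinner : ∀ j, ⟪e j, x - z⟫ = if j ∈ J then 0 else ⟪e j, x⟫ := fun j => by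
    rw [inner_sub_right, hz, inner_sum]
    simp only [inner_smul_right, orthonormal_iff_ite.1 e.orthonormal]
    by_cases hj : j ∈ J <;> simp [hj]
  have hxz : ‖x - z‖ < ε / 2 := hJ _
    (fun j => by rw [hinner]; split_ifs; exacts [by simp, hx j])
    fun j hj => by rw [hinner, if_pos hj, abs_zero]; positivity
  refine Set.mem_iUnion₂.2 ⟨y, hy, Metric.mem_ball.2 ?_⟩
  calc dist x y ≤ dist x z + dist z y := dist_triangle _ _ _
    _ < ε / 2 + ε / 2 := add_lt_add (dist_eq_norm x z ▸ hxz) hzy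
    _ = ε := add_halves ε

end Cube

section Noise

variable {ι Ω E : Type*} [Countable ι] [MeasurableSpace Ω] {Pr : Measure Ω}
  [NormedAddCommGroup E] [InnerProductSpace ℝ E] {e : HilbertBasis ι ℝ E} {b : ι → ℝ}
  {ξ : ι → Ω → ℝ} {X : Ω → E}

theorem ae_mem_cube (hsum : ∀ᵐ ω ∂Pr, HasSum (fun j => (b j * ξ j ω) • e j) (X ω))
    (hξ : ∀ j, ∀ᵐ ω ∂Pr, |ξ j ω| ≤ 1) : ∀ᵐ ω ∂Pr, X ω ∈ cube e b := by
  filter_upwards [hsum, ae_all_iff.2 hξ] with ω hω hξω j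
  rw [inner_eq_of_hasSum e hω j, abs_mul]
  exact mul_le_of_le_one_right (abs_nonneg _) (hξω j)

variable [MeasurableSpace E] [BorelSpace E]

theorem isCompact_support_map (hX : Measurable X) (hb : Summable fun j => b j ^ 2)
    (hsum : ∀ᵐ ω ∂Pr, HasSum (fun j => (b j * ξ j ω) • e j) (X ω))
    (hξ : ∀ j, ∀ᵐ ω ∂Pr, |ξ j ω| ≤ 1) [SecondCountableTopology E] :
    IsCompact (Pr.map X).support :=
  (isCompact_cube e hb).of_isClosed_subset Measure.isClosed_support <|
    Measure.support_subset_of_isClosed (isClosed_cube e b) <|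
      (ae_map_iff hX.aemeasurable (isClosed_cube e b).measurableSet).2 (ae_mem_cube hsum hξ)

theorem zero_mem_support_map (hX : Measurable X) (hb : Summable fun j => b j ^ 2)
    (hsum : ∀ᵐ ω ∂Pr, HasSum (fun j => (b j * ξ j ω) • e j) (X ω))
    (hξ : ∀ j, ∀ᵐ ω ∂Pr, |ξ j ω| ≤ 1) (hξm : ∀ j, Measurable (ξ j)) (hind : iIndepFun ξ Pr)
    (hpos : ∀ j s, 0 < s → Pr.map (ξ j) (Set.Ioo (-s) s) ≠ 0) : (0 : E) ∈ (Pr.map X).support := by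
  refine Metric.nhds_basis_ball.mem_measureSupport.2 fun ε hε => ?_
  rw [Measure.map_apply hX Metric.isOpen_ball.measurableSet]
  obtain ⟨J, s, hs, hJ⟩ := exists_finset_norm_lt_of_mem_cube e hb hε
  have hsub : (⋂ j ∈ J, ξ j ⁻¹' Set.Ioo (-s) s : Set Ω) ≤ᵐ[Pr] X ⁻¹' Metric.ball 0 ε := by
    filter_upwards [hsum, ae_mem_cube hsum hξ] with ω hω hcube hωJ
    refine mem_ball_zero_iff.2 (hJ _ hcube fun j hj => ?_)
    rw [inner_eq_of_hasSum e hω j, abs_mul, mul_comm]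
    gcongr
    exact (abs_lt.2 (Set.mem_iInter₂.1 hωJ j hj)).le
  refine lt_of_lt_of_le ?_ (measure_mono_ae hsub)
  rw [hind.measure_inter_preimage_eq_mul J (sets := fun _ => Set.Ioo (-s) s)
    fun j _ => measurableSet_Ioo]
  refine pos_iff_ne_zero.2 (Finset.prod_ne_zero_iff.2 fun j _ => ?_)
  rw [← Measure.map_apply (hξm j) measurableSet_Ioo]
  exact hpos j s hs

theorem shearStable_map [IsProbabilityMeasure Pr] [SecondCountableTopology E]
    (hsum : ∀ᵐ ω ∂Pr, HasSum (fun j => (b j * ξ j ω) • e j) (X ω))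
    (hξm : ∀ j, Measurable (ξ j)) (hind : iIndepFun ξ Pr) {j : ι} (hb : b j ≠ 0)
    (hξ : ShearStable (Pr.map (ξ j)) 1) : ShearStable (Pr.map X) (e j) := by
  have : CompleteSpace E := e.repr.toIsometryEquiv.completeSpace
  obtain ⟨ν, hν, hmap⟩ := exists_map_eq_map_prod_add_smul (a := fun j => b j • e j)
    (hsum.mono fun ω hω => by simpa only [smul_smul, mul_comm] using hω) hξm hind j
  rw [hmap]
  exact hξ.map_prod_add_smul hb (e j)

theorem withDensity_Ioo_ne_zero {ρ : ℝ → ℝ} (hρ : Continuous ρ) (h0 : 0 < ρ 0) {s : ℝ}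
    (hs : 0 < s) : volume.withDensity (fun r => ENNReal.ofReal (ρ r)) (Set.Ioo (-s) s) ≠ 0 := by
  rw [Ne, withDensity_apply_eq_zero hρ.measurable.ennreal_ofReal]
  have hopen : IsOpen ({r | 0 < ρ r} ∩ Set.Ioo (-s) s) :=
    (isOpen_lt continuous_const hρ).inter isOpen_Ioo
  exact ((hopen.measure_pos volume ⟨0, h0, by simpa using hs⟩).trans_le
    (measure_mono fun r hr => by simpa using hr)).ne'

theorem Decomposable.shearStable_and_support [IsProbabilityMeasure Pr] [SecondCountableTopology E]
    {η : ℕ → Ω → E} {ℓ : Measure E} (h : Decomposable ι Pr η) (hη : IsIIDWithLaw Pr η ℓ) :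
    ∃ e : HilbertBasis ι ℝ E, (∀ j, ShearStable ℓ (e j)) ∧ IsCompact ℓ.support ∧
      (0 : E) ∈ ℓ.support := by
  obtain ⟨e, b, ξ, ρ, hsum, hb, hb2, hξm, hind, hξ1, hρ, hlaw, hlip, hρ0⟩ := h
  have hind0 : iIndepFun (fun j => ξ j 0) Pr :=
    hind.precomp (g := fun j : ι => (j, 0)) fun i j hij => (Prod.ext_iff.1 hij).1
  have hshear : ∀ j, ShearStable (Pr.map (ξ j 0)) 1 := fun j => by
    obtain ⟨L, hL⟩ := hlip j
    have hprob := Measure.isProbabilityMeasure_map (μ := Pr) (hξm j 0).aemeasurable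
    have hle : ∀ᵐ r ∂Pr.map (ξ j 0), |r| ≤ 1 := (ae_map_iff (hξm j 0).aemeasurable
      (measurableSet_le (by fun_prop) measurable_const)).2 (hξ1 j 0)
    rw [hlaw j 0] at hprob hle ⊢
    exact shearStable_withDensity_of_lipschitz hL hle
  have hpos : ∀ j s, 0 < s → Pr.map (ξ j 0) (Set.Ioo (-s) s) ≠ 0 := fun j s hs => by
    obtain ⟨L, hL⟩ := hlip j
    rw [hlaw j 0]
    exact withDensity_Ioo_ne_zero hL.continuous ((hρ j 0).lt_of_ne' (hρ0 j)) hs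
  rw [← hη.law 0]
  exact ⟨e, fun j => shearStable_map (hsum 0) (fun j => hξm j 0) hind0 (hb j) (hshear j),
    isCompact_support_map (hη.measurable 0) hb2 (hsum 0) fun j => hξ1 j 0,
    zero_mem_support_map (hη.measurable 0) hb2 (hsum 0) (fun j => hξ1 j 0)
      (fun j => hξm j 0) hind0 hpos⟩

end Noise

section LipschitzSelection

variable {X F : Type*} [PseudoMetricSpace X] [SeminormedAddCommGroup F] [NormedSpace ℝ F]

theorem lipschitzWith_smul_of_norm_le {χ : X → ℝ} {G : X → F} {a C M : ℝ≥0}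
    (hχ : LipschitzWith a χ) (hχ1 : ∀ x, |χ x| ≤ 1) (hG : LipschitzWith C G)
    (hGM : ∀ x, ‖G x‖ ≤ M) : LipschitzWith (a * M + C) fun x => χ x • G x := by
  refine LipschitzWith.of_dist_le_mul fun x y => ?_
  have hsplit : χ x • G x - χ y • G y = (χ x - χ y) • G x + χ y • (G x - G y) := by
    rw [sub_smul, smul_sub]; abel
  rw [dist_eq_norm, hsplit]
  calc ‖(χ x - χ y) • G x + χ y • (G x - G y)‖
      ≤ dist (χ x) (χ y) * ‖G x‖ + |χ y| * dist (G x) (G y) := by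
        simpa only [norm_smul, dist_eq_norm, Real.norm_eq_abs] using
          norm_add_le ((χ x - χ y) • G x) (χ y • (G x - G y))
    _ ≤ (a * dist x y) * M + 1 * (C * dist x y) := by
        gcongr
        · exact hχ.dist_le_mul x y
        · exact hGM x
        · exact hχ1 y
        · exact hG.dist_le_mul x y
    _ = ↑(a * M + C) * dist x y := by push_cast; ring

theorem exists_lipschitzWith_cutoff (z : X) {r : ℝ} (hr : 0 < r) :
    ∃ (χ : X → ℝ) (a : ℝ≥0), LipschitzWith a χ ∧ (∀ x, χ x ∈ Set.Icc (0 : ℝ) 1) ∧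
      (∀ x ∈ Metric.ball z (r / 2), χ x = 1) ∧ ∀ x ∉ Metric.ball z r, χ x = 0 := by
  refine ⟨fun x => max 0 (min 1 (2 - 2 / r * dist x z)), _,
    ((LipschitzWith.of_dist_le_mul (K := (2 / r).toNNReal) fun x y => ?_).const_min 1).const_max 0,
    fun x => ⟨le_max_left _ _, max_le zero_le_one (min_le_left _ _)⟩,
    fun x hx => ?_, fun x hx => ?_⟩
  · rw [Real.dist_eq, sub_sub_sub_cancel_left, ← mul_sub, abs_mul, abs_of_pos (by positivity),
      Real.coe_toNNReal _ (by positivity), dist_comm x y]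
    gcongr
    exact abs_dist_sub_le y x z
  · have hle : 2 / r * dist x z ≤ 2 / r * (r / 2) := by gcongr; exact (Metric.mem_ball.1 hx).le
    have hone : 2 / r * (r / 2) = 1 := by field_simp
    beta_reduce
    rw [min_eq_left (by linarith), max_eq_right zero_le_one]
  · have hle : 2 / r * r ≤ 2 / r * dist x z := by
      gcongr; exact not_lt.1 fun h => hx (Metric.mem_ball.2 h)
    have htwo : 2 / r * r = 2 := by field_simp
    beta_reduce
    rw [min_eq_right (by linarith), max_eq_left (by linarith)]

theorem exists_lipschitzWith_selection_union_ball {T : X → Set F} (hconv : ∀ x, Convex ℝ (T x))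
    {z : X} {r : ℝ} (hr : 0 < r) {R : F} (hR : ∀ x ∈ Metric.ball z r, R ∈ T x) {s : Set X}
    (hs : ∃ (G : X → F) (C : ℝ≥0), LipschitzWith C G ∧ (∀ x, ‖G x‖ ≤ C) ∧ ∀ x ∈ s, G x ∈ T x) :
    ∃ (G : X → F) (C : ℝ≥0), LipschitzWith C G ∧ (∀ x, ‖G x‖ ≤ C) ∧
      ∀ x ∈ s ∪ Metric.ball z (r / 2), G x ∈ T x := by
  obtain ⟨G, C, hGlip, hGC, hGT⟩ := hs
  obtain ⟨χ, a, hχlip, hχ, hχ1, hχ0⟩ := exists_lipschitzWith_cutoff z hr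
  have hχ_abs : ∀ x, |χ x| ≤ 1 := fun x => abs_le.2 ⟨by linarith [(hχ x).1], (hχ x).2⟩
  have hdiff : ∀ x, ‖R - G x‖ ≤ ↑(‖R‖₊ + C) := fun x =>
    (norm_sub_le _ _).trans (add_le_add_right (hGC x) _)
  have hdiff_lip : LipschitzWith C fun x => R - G x := by
    simpa only [zero_add] using (LipschitzWith.const R).sub hGlip
  refine ⟨fun x => G x + χ x • (R - G x), C + (a * (‖R‖₊ + C) + (‖R‖₊ + C)), ?_, fun x => ?_, ?_⟩
  · refine (hGlip.add (lipschitzWith_smul_of_norm_le hχlip hχ_abs hdiff_lip hdiff)).weaken ?_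
    gcongr
    exact le_add_self
  · push_cast
    refine (norm_add_le _ _).trans (add_le_add (hGC x) ?_)
    rw [norm_smul, Real.norm_eq_abs]
    have hle : |χ x| * ‖R - G x‖ ≤ 1 * (‖R‖ + C) :=
      mul_le_mul (hχ_abs x) (hdiff x) (norm_nonneg _) zero_le_one
    have hnonneg : 0 ≤ (a : ℝ) * (‖R‖ + C) := by positivity
    linarith
  · rintro x (hx | hx)
    · by_cases hxr : x ∈ Metric.ball z r
      · exact (hconv x).add_smul_sub_mem (hGT x hx) (hR x hxr) (hχ x)
      · simpa only [hχ0 x hxr, zero_smul, add_zero] using hGT x hx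
    · simpa only [hχ1 x hx, one_smul, add_sub_cancel] using
        hR x (Metric.ball_subset_ball (half_le_self hr.le) hx)

theorem exists_lipschitzWith_forall_mem_of_convex {T : X → Set F} (hconv : ∀ x, Convex ℝ (T x))
    {Z : Set X} (hZ : IsCompact Z) (hloc : ∀ z ∈ Z, ∃ R, ∀ᶠ x in 𝓝 z, R ∈ T x) :
    ∃ (G : X → F) (C : ℝ≥0), LipschitzWith C G ∧ (∀ x, ‖G x‖ ≤ C) ∧ ∀ z ∈ Z, G z ∈ T z := by
  suffices hext : ∀ t : Set X,
      (∃ (G : X → F) (C : ℝ≥0), LipschitzWith C G ∧ (∀ x, ‖G x‖ ≤ C) ∧ ∀ x ∈ t, G x ∈ T x) →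
      ∃ (G : X → F) (C : ℝ≥0), LipschitzWith C G ∧ (∀ x, ‖G x‖ ≤ C) ∧
        ∀ x ∈ t ∪ Z, G x ∈ T x by
    simpa only [Set.empty_union] using
      hext ∅ ⟨fun _ => 0, 0, LipschitzWith.const 0, fun _ => norm_zero.le, fun _ h => h.elim⟩
  refine hZ.induction_on (fun t ht => by rwa [Set.union_empty])
    (fun s s' hss hs' t ht => ?_) (fun s s' hs hs' t ht => ?_) fun z hz => ?_
  · obtain ⟨G, C, hlip, hbound, hG⟩ := hs' t ht
    exact ⟨G, C, hlip, hbound, fun x hx => hG x (Set.union_subset_union_right t hss hx)⟩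
  · rw [← Set.union_assoc]
    exact hs' _ (hs t ht)
  · obtain ⟨R, hR⟩ := hloc z hz
    obtain ⟨r, hr, hrR⟩ := Metric.eventually_nhds_iff_ball.1 hR
    exact ⟨Metric.ball z (r / 2), mem_nhdsWithin_of_mem_nhds (Metric.ball_mem_nhds z (half_pos hr)),
      fun t ht => exists_lipschitzWith_selection_union_ball hconv hr hrR ht⟩

end LipschitzSelection

section ApproximateInverse

variable {ι X G E H : Type*} [NormedAddCommGroup G] [NormedSpace ℝ G]
  [NormedAddCommGroup E] [NormedSpace ℝ E]

theorem exists_finset_forall_exists_mem_span_norm_add_lt [NormedAddCommGroup H] [NormedSpace ℝ H]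
    {e : ι → E} (he : Dense (Submodule.span ℝ (Set.range e) : Set E)) {A : E →L[ℝ] H}
    (hA : DenseRange A) {K : Set H} (hK : IsCompact K) {ε : ℝ} (hε : 0 < ε) :
    ∃ J : Finset ι, ∀ y ∈ K, ∃ x ∈ Submodule.span ℝ (e '' J), ‖y + A x‖ < ε := by
  classical
  let U : Finset ι → Set H := fun J => ⋃ x ∈ Submodule.span ℝ (e '' J), {y | ‖y + A x‖ < ε}
  have hU_mono : Monotone U := fun J J' hJ => Set.biUnion_subset_biUnion_left fun x hx =>
    Submodule.span_mono (Set.image_mono (Finset.coe_subset.2 hJ)) hx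
  have hcover : K ⊆ ⋃ J, U J := fun y _ => by
    obtain ⟨_, ⟨x, hx, rfl⟩, hdist⟩ :=
      (hA.dense_image A.continuous he).exists_dist_lt (-y) hε
    obtain ⟨c, rfl⟩ := Finsupp.mem_span_range_iff_exists_finsupp.1 hx
    have hspan : (c.sum fun j t => t • e j) ∈ Submodule.span ℝ (e '' (c.support : Set ι)) :=
      Submodule.sum_mem _ fun j hj => Submodule.smul_mem _ _ (Submodule.subset_span ⟨j, hj, rfl⟩)
    refine Set.mem_iUnion.2 ⟨c.support, Set.mem_biUnion hspan ?_⟩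
    rwa [dist_comm, dist_eq_norm, sub_neg_eq_add, add_comm] at hdist
  obtain ⟨J, hJ⟩ := hK.elim_directed_cover U (fun J => isOpen_biUnion fun x _ =>
    isOpen_lt (by fun_prop) continuous_const) hcover hU_mono.directed_le
  refine ⟨J, fun y hy => ?_⟩
  obtain ⟨x, hx, hlt⟩ := Set.mem_iUnion₂.1 (hJ hy)
  exact ⟨x, hx, hlt⟩

/-- The operators `R` with values in `W` for which moving the argument of `A` by `R h` compensates,
up to the error `ε * ‖h‖`, a displacement `D h`. -/
def corrections [NormedAddCommGroup H] [NormedSpace ℝ H] (W : Submodule ℝ E) (ε : ℝ)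
    (D : G →L[ℝ] H) (A : E →L[ℝ] H) : Set (G →L[ℝ] E) :=
  {R | (∀ h, R h ∈ W) ∧ ‖D + A.comp R‖ ≤ ε}

theorem convex_corrections [NormedAddCommGroup H] [NormedSpace ℝ H] (W : Submodule ℝ E) (ε : ℝ)
    (D : G →L[ℝ] H) (A : E →L[ℝ] H) : Convex ℝ (corrections W ε D A) := by
  rintro R ⟨hRW, hR⟩ R' ⟨hRW', hR'⟩ a b ha hb hab
  refine ⟨fun h => W.add_mem (W.smul_mem a (hRW h)) (W.smul_mem b (hRW' h)), ?_⟩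
  have hsplit : D + A.comp (a • R + b • R') = a • (D + A.comp R) + b • (D + A.comp R') := by
    rw [smul_add, smul_add, add_add_add_comm, ← add_smul, hab, one_smul, A.comp_add,
      A.comp_smul, A.comp_smul]
  rw [hsplit, ← mem_closedBall_zero_iff]
  exact convex_closedBall 0 ε (mem_closedBall_zero_iff.2 hR) (mem_closedBall_zero_iff.2 hR')
    ha hb hab

theorem eventually_mem_corrections [NormedAddCommGroup H] [NormedSpace ℝ H] [TopologicalSpace X]
    {D : X → G →L[ℝ] H} {A : X → E →L[ℝ] H} (hD : Continuous D) (hA : Continuous A)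
    {W : Submodule ℝ E} {ε ε' : ℝ} (hε : ε < ε') {z : X} {R : G →L[ℝ] E}
    (hR : R ∈ corrections W ε (D z) (A z)) : ∀ᶠ x in 𝓝 z, R ∈ corrections W ε' (D x) (A x) := by
  have hcont : Continuous fun x => ‖D x + (A x).comp R‖ := by fun_prop
  filter_upwards [hcont.tendsto z |>.eventually_lt_const (hR.2.trans_lt hε)] with x hx
  exact ⟨hR.1, hx.le⟩

variable [NormedAddCommGroup H] [InnerProductSpace ℝ H]

theorem norm_sub_starProjection_comp_le {D : G →L[ℝ] H} (W : Submodule ℝ H)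
    [W.HasOrthogonalProjection] {ε : ℝ} (hε : 0 ≤ ε)
    (hDW : ∀ h, ‖h‖ ≤ 1 → ∃ w ∈ W, ‖D h + w‖ ≤ ε) : ‖D - W.starProjection.comp D‖ ≤ ε := by
  refine ContinuousLinearMap.opNorm_le_of_unit_norm hε fun h hh => ?_
  obtain ⟨w, hw, hle⟩ := hDW h hh.le
  rw [sub_apply, ContinuousLinearMap.comp_apply, Submodule.starProjection_minimal]
  refine (ciInf_le ⟨0, ?_⟩ (⟨-w, W.neg_mem hw⟩ : W)).trans (by rwa [sub_neg_eq_add])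
  rintro _ ⟨x, rfl⟩
  exact norm_nonneg _

theorem exists_mem_corrections {e : ι → E} (he : Dense (Submodule.span ℝ (Set.range e) : Set E))
    {D : G →L[ℝ] H} (hD : IsCompactOperator D) {A : E →L[ℝ] H} (hA : DenseRange A) {ε : ℝ}
    (hε : 0 < ε) :
    ∃ (J : Finset ι) (R : G →L[ℝ] E), R ∈ corrections (Submodule.span ℝ (e '' J)) ε D A := by
  obtain ⟨J, hJ⟩ := exists_finset_forall_exists_mem_span_norm_add_lt he hA
    (hD.isCompact_closure_image_closedBall (f := (D : G →ₗ[ℝ] H)) 1) hε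
  let U : Submodule ℝ E := Submodule.span ℝ (e '' J)
  let B : U →ₗ[ℝ] H := (A : E →ₗ[ℝ] H).comp U.subtype
  have : FiniteDimensional ℝ U := .span_of_finite ℝ (J.finite_toSet.image e)
  obtain ⟨g, hg⟩ := B.rangeRestrict.exists_rightInverse_of_surjective B.range_rangeRestrict
  let R : G →L[ℝ] E := -(U.subtypeL.comp (g.toContinuousLinearMap.comp
    ((LinearMap.range B).orthogonalProjectionOnto.comp D)))
  have hAR : A.comp R = -((LinearMap.range B).starProjection.comp D) := by
    ext h
    have hBg : ∀ w, B (g w) = w := fun w => congrArg Subtype.val (LinearMap.congr_fun hg w)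
    change A (-(g _ : E)) = -_
    rw [map_neg]
    exact congrArg Neg.neg (hBg ((LinearMap.range B).orthogonalProjectionOnto (D h)))
  refine ⟨J, R, fun h => U.neg_mem (g _).2, ?_⟩
  rw [hAR, ← sub_eq_add_neg]
  refine norm_sub_starProjection_comp_le _ hε.le fun h hh => ?_
  obtain ⟨x, hx, hlt⟩ := hJ (D h) (subset_closure ⟨h, mem_closedBall_zero_iff.2 hh, rfl⟩)
  exact ⟨A x, ⟨⟨x, hx⟩, rfl⟩, hlt.le⟩

theorem exists_finset_forall_eventually_mem_corrections [TopologicalSpace X] {e : ι → E}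
    (he : Dense (Submodule.span ℝ (Set.range e) : Set E)) {D : X → G →L[ℝ] H}
    {A : X → E →L[ℝ] H} (hD : Continuous D) (hA : Continuous A) {Z : Set X} (hZ : IsCompact Z)
    (hDc : ∀ z ∈ Z, IsCompactOperator (D z)) (hAd : ∀ z ∈ Z, DenseRange (A z)) {ε : ℝ}
    (hε : 0 < ε) : ∃ J : Finset ι, ∀ z ∈ Z, ∃ R : G →L[ℝ] E,
      ∀ᶠ x in 𝓝 z, R ∈ corrections (Submodule.span ℝ (e '' J)) ε (D x) (A x) := by
  classical
  have hmono : ∀ {J J' : Finset ι} {x : X} {R : G →L[ℝ] E}, J ⊆ J' →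
      R ∈ corrections (Submodule.span ℝ (e '' J)) ε (D x) (A x) →
      R ∈ corrections (Submodule.span ℝ (e '' J')) ε (D x) (A x) := fun hJ hR =>
    ⟨fun h => Submodule.span_mono (Set.image_mono (Finset.coe_subset.2 hJ)) (hR.1 h), hR.2⟩
  refine hZ.induction_on ⟨∅, fun z hz => hz.elim⟩
    (fun s t hst ⟨J, hJ⟩ => ⟨J, fun z hz => hJ z (hst hz)⟩) ?_ fun z hz => ?_
  · rintro s t ⟨J, hJ⟩ ⟨J', hJ'⟩
    refine ⟨J ∪ J', fun z hz => ?_⟩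
    rcases hz with hz | hz
    · exact (hJ z hz).imp fun R hR => hR.mono fun x => hmono Finset.subset_union_left
    · exact (hJ' z hz).imp fun R hR => hR.mono fun x => hmono Finset.subset_union_right
  · obtain ⟨J, R, hR⟩ := exists_mem_corrections he (hDc z hz) (hAd z hz) (half_pos hε)
    exact ⟨_, mem_nhdsWithin_of_mem_nhds
      (eventually_mem_corrections hD hA (half_lt_self hε) hR).eventually_nhds,
      J, fun y hy => ⟨R, hy⟩⟩

theorem exists_lipschitzWith_forall_mem_corrections [PseudoMetricSpace X] {e : ι → E}
    (he : Dense (Submodule.span ℝ (Set.range e) : Set E)) {D : X → G →L[ℝ] H}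
    {A : X → E →L[ℝ] H} (hD : Continuous D) (hA : Continuous A) {Z : Set X} (hZ : IsCompact Z)
    (hDc : ∀ z ∈ Z, IsCompactOperator (D z)) (hAd : ∀ z ∈ Z, DenseRange (A z)) {ε : ℝ}
    (hε : 0 < ε) : ∃ (J : Finset ι) (R : X → G →L[ℝ] E) (C : ℝ≥0), LipschitzWith C R ∧
      (∀ x, ‖R x‖ ≤ C) ∧
      ∀ z ∈ Z, R z ∈ corrections (Submodule.span ℝ (e '' J)) ε (D z) (A z) := by
  obtain ⟨J, hJ⟩ := exists_finset_forall_eventually_mem_corrections he hD hA hZ hDc hAd hε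
  exact ⟨J, exists_lipschitzWith_forall_mem_of_convex
    (T := fun x => corrections (Submodule.span ℝ (e '' J)) ε (D x) (A x))
    (fun x => convex_corrections _ ε _ _) hZ hJ⟩

end ApproximateInverse

section Regularity

variable {H E V : Type*} [NormedAddCommGroup H] [NormedSpace ℝ H]
  [NormedAddCommGroup E] [NormedSpace ℝ E] [NormedAddCommGroup V] [NormedSpace ℝ V]
  {S : H × E → V} {B : Set (H × E)}

theorem Regular.differentiable (hS : Regular S) : Differentiable ℝ S :=
  hS.contDiff.differentiable (by norm_num)

theorem Regular.exists_lipschitzOnWith (hS : Regular S) (hB : Bornology.IsBounded B) :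
    ∃ C : ℝ≥0, LipschitzOnWith C S B := by
  obtain ⟨r, hr⟩ := hB.subset_closedBall 0
  obtain ⟨C, hC⟩ := hS.bounded (Metric.closedBall 0 r) Metric.isBounded_closedBall
  exact ⟨C.toNNReal, ((convex_closedBall _ _).lipschitzOnWith_of_nnnorm_fderiv_le
    (fun z _ => hS.differentiable z)
    fun z hz => (hC z hz).1.trans (Real.le_coe_toNNReal C)).mono hr⟩

theorem Regular.isBounded_image (hS : Regular S) (hB : Bornology.IsBounded B) :
    Bornology.IsBounded (S '' B) := by
  obtain ⟨C, hC⟩ := hS.exists_lipschitzOnWith hB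
  obtain ⟨D, hD⟩ := Metric.isBounded_iff.1 hB
  refine Metric.isBounded_iff.2 ⟨C * D, ?_⟩
  rintro _ ⟨x, hx, rfl⟩ _ ⟨y, hy, rfl⟩
  exact (hC.dist_le_mul x hx y hy).trans (mul_le_mul_of_nonneg_left (hD hx hy) C.2)

theorem Regular.exists_norm_sub_sub_fderiv_le (hS : Regular S) (hB : Bornology.IsBounded B) :
    ∃ C : ℝ≥0, ∀ z ∈ B, ∀ y ∈ B, ‖S y - S z - fderiv ℝ S z (y - z)‖ ≤ C * ‖y - z‖ ^ 2 := by
  obtain ⟨r, hr⟩ := hB.subset_closedBall 0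
  obtain ⟨C, hC⟩ := hS.bounded (Metric.closedBall 0 r) Metric.isBounded_closedBall
  have hconv : Convex ℝ (Metric.closedBall (0 : H × E) r) := convex_closedBall _ _
  have hdiff : Differentiable ℝ (fderiv ℝ S) :=
    (hS.contDiff.fderiv_right (m := 1) (by norm_num)).differentiable (by norm_num)
  refine ⟨C.toNNReal, fun z hz y hy => ?_⟩
  have hderiv : ∀ x ∈ segment ℝ z y,
      ‖fderiv ℝ S x - fderiv ℝ S z‖ ≤ C.toNNReal * ‖y - z‖ := fun x hx => by
    refine (hconv.norm_image_sub_le_of_norm_fderiv_le (fun w _ => hdiff w)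
      (fun w hw => (hC w hw).2.trans (Real.le_coe_toNNReal C)) (hr hz)
      (hconv.segment_subset (hr hz) (hr hy) hx)).trans ?_
    gcongr
    exact norm_sub_le_of_mem_segment hx
  have hmvt := (convex_segment z y).norm_image_sub_le_of_norm_hasFDerivWithin_le'
    (f := S) (f' := fderiv ℝ S) (φ := fderiv ℝ S z)
    (fun x _ => (hS.differentiable x).hasFDerivAt.hasFDerivWithinAt) hderiv
    (left_mem_segment ℝ z y) (right_mem_segment ℝ z y)
  rwa [mul_assoc, ← sq] at hmvt

theorem Regular.exists_norm_add_sub_sub_fderiv_le (hS : Regular S) (hB : Bornology.IsBounded B)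
    (a : ℝ≥0) : ∃ C : ℝ≥0, ∀ z ∈ B, ∀ (w g : H × E) (t : ℝ), t ≤ 1 → ‖w‖ ≤ a * t →
      ‖w - g‖ ≤ a * t ^ 2 → ‖S (z + w) - S z - fderiv ℝ S z g‖ ≤ C * t ^ 2 := by
  obtain ⟨r, hr⟩ := hB.subset_closedBall 0
  obtain ⟨C₁, hC₁⟩ := hS.bounded B hB
  obtain ⟨C₂, hC₂⟩ := hS.exists_norm_sub_sub_fderiv_le
    (Metric.isBounded_closedBall (x := (0 : H × E)) (r := r + a))
  refine ⟨C₂ * a ^ 2 + C₁.toNNReal * a, fun z hz w g t ht hw hwg => ?_⟩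
  have hz_norm : ‖z‖ ≤ r := mem_closedBall_zero_iff.1 (hr hz)
  have hzw_norm : ‖z + w‖ ≤ r + a := (norm_add_le _ _).trans
    (add_le_add hz_norm (hw.trans (mul_le_of_le_one_right a.2 ht)))
  have htaylor := hC₂ z (mem_closedBall_zero_iff.2 (hz_norm.trans (le_add_of_nonneg_right a.2)))
    (z + w) (mem_closedBall_zero_iff.2 hzw_norm)
  rw [add_sub_cancel_left] at htaylor
  calc ‖S (z + w) - S z - fderiv ℝ S z g‖
      = ‖(S (z + w) - S z - fderiv ℝ S z w) + fderiv ℝ S z (w - g)‖ := by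
        rw [map_sub, sub_add_sub_cancel]
    _ ≤ C₂ * ‖w‖ ^ 2 + C₁.toNNReal * ‖w - g‖ := (norm_add_le _ _).trans <| add_le_add htaylor <|
        ContinuousLinearMap.le_of_opNorm_le _
          ((hC₁ z hz).1.trans (Real.le_coe_toNNReal C₁)) _
    _ ≤ C₂ * (a * t) ^ 2 + C₁.toNNReal * (a * t ^ 2) := by gcongr
    _ = ↑(C₂ * a ^ 2 + C₁.toNNReal * a) * t ^ 2 := by push_cast; ring

end Regularity

section OneStep

/-- Moving the starting point from `u` to `u'` can be compensated, up to half of the displacement,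
by a change `Ψ` of the noise that distorts its law by at most `C * ‖u' - u‖`. -/
def Halving {H E : Type*} [NormedAddCommGroup H] [MeasurableSpace E] (ℓ : Measure E)
    (F : H × E → H) (K : Set E) (X : Set H) (δ : ℝ) (C : ℝ≥0) : Prop :=
  ∀ u ∈ X, ∀ u' ∈ X, ‖u' - u‖ ≤ δ → ∃ Ψ : E → E, AlmostPreserves ℓ Ψ (C * ‖u' - u‖₊) ∧
    ∀ ζ ∈ K, ‖F (u', Ψ ζ) - F (u, ζ)‖ ≤ ‖u' - u‖ / 2

variable {ι E : Type*} [NormedAddCommGroup E] [InnerProductSpace ℝ E] {e : ι → E}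

theorem sum_inner_smul_of_mem_span (he : Orthonormal ℝ e) {J : Finset ι} {x : E}
    (hx : x ∈ Submodule.span ℝ (e '' J)) : ∑ j ∈ J, ⟪e j, x⟫ • e j = x := by
  obtain ⟨c, rfl⟩ := (Submodule.mem_span_image_finset_iff_exists_fun' ℝ).1 hx
  exact Finset.sum_congr rfl fun j hj => by rw [he.inner_right_sum c hj]

theorem exists_almostPreserves_near_add [MeasurableSpace E] {ℓ : Measure E}
    (he : Orthonormal ℝ e) (hs : ∀ j, ShearStable ℓ (e j)) (J : Finset ι) :
    ∃ C : ℝ≥0, ∀ (M : ℝ≥0) (g : E → E), LipschitzWith M g → (∀ x, ‖g x‖ ≤ M) →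
      ∃ Ψ : E → E, AlmostPreserves ℓ Ψ (C * M) ∧ ∀ x, ‖Ψ x - x‖ ≤ C * M ∧
        (g x ∈ Submodule.span ℝ (e '' J) → ‖Ψ x - x - g x‖ ≤ C * M ^ 2) := by
  obtain ⟨C, hC⟩ := exists_almostPreserves_of_shearStable (fun j => (he.1 j).le) hs J
  refine ⟨C + J.card + J.card ^ 2, fun M g hg hgM => ?_⟩
  have hinner : ∀ j x, ‖⟪e j, x⟫‖ ≤ ‖x‖ := fun j x =>
    (norm_inner_le_norm (e j) x).trans_eq (by rw [he.1 j, one_mul])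
  obtain ⟨Ψ, hΨ, hΨg⟩ := hC M (fun j x => ⟪e j, g x⟫)
    (fun j => LipschitzWith.of_dist_le_mul fun x y => by
      rw [dist_eq_norm, ← inner_sub_right]
      exact (hinner j _).trans ((dist_eq_norm (g x) (g y)).symm.trans_le (hg.dist_le_mul x y)))
    fun j x => (hinner j _).trans (hgM x)
  refine ⟨Ψ, hΨ.mono ?_, fun x => ⟨(hΨg x).1.trans ?_, fun hx => ?_⟩⟩
  · gcongr
    rw [add_assoc]
    exact le_self_add
  · push_cast
    gcongr
    nlinarith [C.2, sq_nonneg (J.card : ℝ)]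
  · have hnear := (hΨg x).2
    rw [sum_inner_smul_of_mem_span he hx] at hnear
    refine hnear.trans ?_
    push_cast
    gcongr
    exact le_add_of_nonneg_left (by positivity)

variable {H V : Type*} [NormedAddCommGroup H] [InnerProductSpace ℝ H]
  [NormedAddCommGroup V] [NormedSpace ℝ V] {emb : V →L[ℝ] H} {S : H × E → V} {K : Set E}

theorem NonDegenerate.denseRange_fderiv_comp_inr (hN : NonDegenerate emb S K)
    (hS : Differentiable ℝ S) {z : H × E} (hz : z.2 ∈ K) :
    DenseRange (emb.comp ((fderiv ℝ S z).comp (ContinuousLinearMap.inr ℝ H E))) := by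
  have hpartial : fderiv ℝ (fun x => S (z.1, x)) z.2 =
      (fderiv ℝ S z).comp (ContinuousLinearMap.inr ℝ H E) :=
    ((hS z).hasFDerivAt.comp z.2 (hasFDerivAt_prodMk_right z.1 z.2)).fderiv
  rw [← hpartial]
  exact hN z.1 z.2 hz

theorem NonDegenerate.exists_lipschitzWith_norm_fderiv_le (hN : NonDegenerate emb S K)
    (he : Dense (Submodule.span ℝ (Set.range e) : Set E)) (hemb : IsCompactOperator emb)
    (hS : ContDiff ℝ 1 S) (hK : IsCompact K) {X : Set H} (hX : IsCompact X) {ε : ℝ}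
    (hε : 0 < ε) : ∃ (J : Finset ι) (R : H × E → H →L[ℝ] E) (C : ℝ≥0), LipschitzWith C R ∧
      (∀ z, ‖R z‖ ≤ C) ∧ ∀ z ∈ X ×ˢ K, ∀ h, R z h ∈ Submodule.span ℝ (e '' J) ∧
        ‖emb (fderiv ℝ S z (h, R z h))‖ ≤ ε * ‖h‖ := by
  have := hS.continuous_fderiv (by norm_num)
  obtain ⟨J, R, C, hlip, hC, hR⟩ := exists_lipschitzWith_forall_mem_corrections he
    (D := fun z => emb.comp ((fderiv ℝ S z).comp (ContinuousLinearMap.inl ℝ H E)))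
    (A := fun z => emb.comp ((fderiv ℝ S z).comp (ContinuousLinearMap.inr ℝ H E)))
    (by fun_prop) (by fun_prop) (hX.prod hK) (fun z _ => hemb.comp_clm _)
    (fun z hz => hN.denseRange_fderiv_comp_inr (hS.differentiable (by norm_num)) hz.2) hε
  refine ⟨J, R, C, hlip, hC, fun z hz h => ⟨(hR z hz).1 h, ?_⟩⟩
  have hbound := ContinuousLinearMap.le_of_opNorm_le _ (hR z hz).2 h
  have hsplit : (h, R z h) = (h, 0) + (0, R z h) := by simp
  rwa [hsplit, map_add, map_add]

theorem NonDegenerate.exists_almostPreserves_norm_fderiv_le [MeasurableSpace E] {ℓ : Measure E}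
    (hN : NonDegenerate emb S K) (he : Orthonormal ℝ e)
    (hdense : Dense (Submodule.span ℝ (Set.range e) : Set E)) (hemb : IsCompactOperator emb)
    (hS : ContDiff ℝ 1 S) (hs : ∀ j, ShearStable ℓ (e j)) (hK : IsCompact K) {X : Set H}
    (hX : IsCompact X) {ε : ℝ} (hε : 0 < ε) :
    ∃ C : ℝ≥0, ∀ u ∈ X, ∀ h, ∃ Ψ : E → E, AlmostPreserves ℓ Ψ (C * ‖h‖₊) ∧
      ∀ ζ ∈ K, ∃ g, ‖emb (fderiv ℝ S (u, ζ) (h, g))‖ ≤ ε * ‖h‖ ∧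
        ‖Ψ ζ - ζ‖ ≤ C * ‖h‖ ∧ ‖Ψ ζ - ζ - g‖ ≤ C * ‖h‖ ^ 2 := by
  obtain ⟨J, R, C₁, hRlip, hRC, hR⟩ :=
    hN.exists_lipschitzWith_norm_fderiv_le hdense hemb hS hK hX hε
  obtain ⟨C₂, hC₂⟩ := exists_almostPreserves_near_add he hs J
  refine ⟨C₂ * C₁ + C₂ * C₁ ^ 2, fun u hu h => ?_⟩
  obtain ⟨Ψ, hΨ, hΨR⟩ := hC₂ (C₁ * ‖h‖₊) (fun ζ => R (u, ζ) h)
    (LipschitzWith.of_dist_le_mul fun ζ ζ' => by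
      have hdist := hRlip.dist_le_mul (u, ζ) (u, ζ')
      rw [dist_prod_same_left, dist_eq_norm] at hdist
      rw [dist_eq_norm, ← sub_apply]
      exact (ContinuousLinearMap.le_of_opNorm_le _ hdist h).trans_eq (mul_right_comm _ _ _))
    fun ζ => ContinuousLinearMap.le_of_opNorm_le _ (hRC _) h
  refine ⟨Ψ, hΨ.mono ?_, fun ζ hζ => ⟨R (u, ζ) h, (hR (u, ζ) ⟨hu, hζ⟩ h).2, ?_, ?_⟩⟩
  · rw [← mul_assoc]
    gcongr
    exact le_self_add
  · refine (hΨR ζ).1.trans ?_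
    rw [NNReal.coe_mul, ← mul_assoc, coe_nnnorm]
    push_cast
    gcongr
    exact le_add_of_nonneg_right (by positivity)
  · refine ((hΨR ζ).2 (hR (u, ζ) ⟨hu, hζ⟩ h).1).trans ?_
    rw [NNReal.coe_mul, mul_pow, ← mul_assoc, coe_nnnorm]
    push_cast
    gcongr
    exact le_add_of_nonneg_left (by positivity)

theorem NonDegenerate.exists_halving [MeasurableSpace E] {ℓ : Measure E}
    (hN : NonDegenerate emb S K) (he : Orthonormal ℝ e)
    (hdense : Dense (Submodule.span ℝ (Set.range e) : Set E)) (hemb : IsCompactOperator emb)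
    (hS : Regular S) (hs : ∀ j, ShearStable ℓ (e j)) (hK : IsCompact K) {X : Set H}
    (hX : IsCompact X) :
    ∃ δ₀ : ℝ, 0 < δ₀ ∧ ∃ C, ∀ δ ≤ δ₀, Halving ℓ (fun z => emb (S z)) K X δ C := by
  obtain ⟨C₁, hC₁⟩ := hN.exists_almostPreserves_norm_fderiv_le he hdense hemb
    (hS.contDiff.of_le (by norm_num)) hs hK hX (ε := 1 / 4) (by norm_num)
  obtain ⟨C₂, hC₂⟩ :=
    hS.exists_norm_add_sub_sub_fderiv_le (hX.prod hK).isBounded (1 + C₁)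
  refine ⟨min 1 (1 / (4 * (‖emb‖ * C₂ + 1))), by positivity, C₁, fun δ hδ u hu u' _ hd => ?_⟩
  obtain ⟨Ψ, hΨ, hΨK⟩ := hC₁ u hu (u' - u)
  refine ⟨Ψ, hΨ, fun ζ hζ => ?_⟩
  obtain ⟨g, hlinear, hnoise, hremainder⟩ := hΨK ζ hζ
  set h := u' - u
  have htaylor := hC₂ (u, ζ) ⟨hu, hζ⟩ (h, Ψ ζ - ζ) (h, g) ‖h‖
    (hd.trans (hδ.trans (min_le_left _ _))) (max_le ?_ (hnoise.trans ?_)) ?_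
  · have hsmall : ‖h‖ * (4 * (‖emb‖ * C₂ + 1)) ≤ 1 :=
      (le_div_iff₀ (by positivity)).1 (hd.trans (hδ.trans (min_le_right _ _)))
    rw [Prod.mk_add_mk, add_sub_cancel, add_sub_cancel] at htaylor
    -- A quarter of `‖h‖` comes from the linear part, another quarter from the Taylor remainder.
    calc ‖emb (S (u', Ψ ζ)) - emb (S (u, ζ))‖
        = ‖emb (S (u', Ψ ζ) - S (u, ζ) - fderiv ℝ S (u, ζ) (h, g)) +
            emb (fderiv ℝ S (u, ζ) (h, g))‖ := by
          rw [← map_add, sub_add_cancel, map_sub]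
      _ ≤ ‖emb‖ * (C₂ * ‖h‖ ^ 2) + 1 / 4 * ‖h‖ :=
          (norm_add_le _ _).trans (add_le_add (emb.le_opNorm_of_le htaylor) hlinear)
      _ ≤ ‖h‖ / 2 := by nlinarith [norm_nonneg h]
  · push_cast
    exact le_mul_of_one_le_left (norm_nonneg h) (le_add_of_nonneg_right C₁.2)
  · push_cast
    gcongr
    exact le_add_of_nonneg_left zero_le_one
  · rw [Prod.mk_sub_mk, sub_self, Prod.norm_mk, norm_zero, max_eq_right (norm_nonneg _)]
    refine hremainder.trans ?_
    push_cast
    gcongr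
    exact le_add_of_nonneg_left zero_le_one

end OneStep

section MarkovOperator

/-- The law of `F (u, ζ)` when `u` and `ζ` are independent with laws `μ` and `ℓ`. -/
noncomputable def stepLaw {H E : Type*} [MeasurableSpace H] [MeasurableSpace E] (ℓ : Measure E)
    (F : H × E → H) (μ : Measure H) : Measure H := (μ.prod ℓ).map F

/-- The Markov operator `f ↦ 𝔼 f (F (·, ζ))`, where `ζ` has law `ℓ`; it is dual to `stepLaw`. -/
noncomputable def markovOp {H E : Type*} [MeasurableSpace E] (ℓ : Measure E)
    (F : H × E → H) (f : H → ℝ) (u : H) : ℝ := ∫ ζ, f (F (u, ζ)) ∂ℓ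

/-- The class of bounded measurable functions, on which the Markov operator acts. -/
structure BoundedMeasurable {H : Type*} [MeasurableSpace H] (f : H → ℝ) : Prop where
  measurable : Measurable f
  bounded : ∃ a, ∀ x, |f x| ≤ a

variable {H E : Type*} [MeasurableSpace H] [MeasurableSpace E] {f : H → ℝ}

theorem BoundedMeasurable.integrable (hf : BoundedMeasurable f) (μ : Measure H)
    [IsFiniteMeasure μ] : Integrable f μ := by
  obtain ⟨a, ha⟩ := hf.bounded
  exact Integrable.of_bound hf.measurable.aestronglyMeasurable a (.of_forall ha)

theorem BoundedMeasurable.comp (hf : BoundedMeasurable f) {g : E → H} (hg : Measurable g) :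
    BoundedMeasurable fun x => f (g x) :=
  ⟨hf.measurable.comp hg, hf.bounded.imp fun _ ha _ => ha _⟩

variable {ℓ : Measure E} {F : H × E → H}

theorem ae_mem_stepLaw (hF : Measurable F) {μ : Measure H} {A B : Set H} {N : Set E}
    (hA : ∀ᵐ u ∂μ, u ∈ A) (hN : ∀ᵐ ζ ∂ℓ, ζ ∈ N) (hB : MeasurableSet B)
    (hAB : ∀ u ∈ A, ∀ ζ ∈ N, F (u, ζ) ∈ B) : ∀ᵐ x ∂stepLaw ℓ F μ, x ∈ B := by
  refine (ae_map_iff hF.aemeasurable hB).2 ?_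
  filter_upwards [Measure.quasiMeasurePreserving_fst.ae hA,
    Measure.quasiMeasurePreserving_snd.ae hN] with z hz hz'
  exact hAB z.1 hz z.2 hz'

theorem ae_mem_iterate_stepLaw (hF : Measurable F) {μ : Measure H} {A : Set H} {N : Set E}
    (hA : ∀ᵐ u ∂μ, u ∈ A) (hN : ∀ᵐ ζ ∂ℓ, ζ ∈ N) (hAm : MeasurableSet A)
    (hAA : ∀ u ∈ A, ∀ ζ ∈ N, F (u, ζ) ∈ A) (k : ℕ) : ∀ᵐ x ∂(stepLaw ℓ F)^[k] μ, x ∈ A := by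
  induction k with
  | zero => exact hA
  | succ k ih =>
    rw [Function.iterate_succ_apply']
    exact ae_mem_stepLaw hF ih hN hAm hAA

variable [IsProbabilityMeasure ℓ]

theorem isProbabilityMeasure_stepLaw (hF : Measurable F) (μ : Measure H) [IsProbabilityMeasure μ] :
    IsProbabilityMeasure (stepLaw ℓ F μ) :=
  Measure.isProbabilityMeasure_map hF.aemeasurable

theorem isProbabilityMeasure_iterate_stepLaw (hF : Measurable F) (μ : Measure H)
    [hμ : IsProbabilityMeasure μ] (k : ℕ) : IsProbabilityMeasure ((stepLaw ℓ F)^[k] μ) := by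
  induction k with
  | zero => exact hμ
  | succ k ih =>
    rw [Function.iterate_succ_apply']
    exact isProbabilityMeasure_stepLaw hF _

theorem BoundedMeasurable.markovOp (hf : BoundedMeasurable f) (hF : Measurable F) :
    BoundedMeasurable (markovOp ℓ F f) := by
  obtain ⟨a, ha⟩ := hf.bounded
  refine ⟨(hf.measurable.comp hF).stronglyMeasurable.integral_prod_right'.measurable, a,
    fun u => ?_⟩
  refine (norm_integral_le_of_norm_le_const (f := fun ζ => f (F (u, ζ)))
    (.of_forall fun ζ => ha (F (u, ζ)))).trans_eq ?_
  rw [probReal_univ, mul_one]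

theorem BoundedMeasurable.iterate_markovOp (hf : BoundedMeasurable f) (hF : Measurable F) (k : ℕ) :
    BoundedMeasurable ((RDS.markovOp ℓ F)^[k] f) := by
  induction k with
  | zero => exact hf
  | succ k ih =>
    rw [Function.iterate_succ_apply']
    exact ih.markovOp hF

theorem integral_stepLaw (hF : Measurable F) (hf : BoundedMeasurable f)
    (μ : Measure H) [IsFiniteMeasure μ] :
    ∫ x, f x ∂(stepLaw ℓ F μ) = ∫ u, markovOp ℓ F f u ∂μ := by
  rw [stepLaw, integral_map hF.aemeasurable hf.measurable.aestronglyMeasurable,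
    integral_prod _ ((hf.comp hF).integrable _)]
  rfl

theorem integral_iterate_stepLaw (hF : Measurable F) (hf : BoundedMeasurable f)
    (μ : Measure H) [IsProbabilityMeasure μ] (k : ℕ) :
    ∫ x, f x ∂((stepLaw ℓ F)^[k] μ) = ∫ u, (markovOp ℓ F)^[k] f u ∂μ := by
  induction k generalizing μ with
  | zero => rfl
  | succ k ih =>
    have := isProbabilityMeasure_stepLaw (ℓ := ℓ) hF μ
    rw [Function.iterate_succ_apply, ih, integral_stepLaw hF (hf.iterate_markovOp hF k),
      Function.iterate_succ_apply']

theorem iterate_markovOp_eq_integral [MeasurableSingletonClass H] (hF : Measurable F)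
    (hf : BoundedMeasurable f) (u : H) (k : ℕ) :
    (markovOp ℓ F)^[k] f u = ∫ x, f x ∂((stepLaw ℓ F)^[k] (Measure.dirac u)) := by
  rw [integral_iterate_stepLaw hF hf, integral_dirac]

theorem mul_le_stepLaw (hF : Measurable F) (μ : Measure H) {A B : Set H} {N : Set E}
    (hB : MeasurableSet B) (hAB : ∀ u ∈ A, ∀ ζ ∈ N, F (u, ζ) ∈ B) :
    μ A * ℓ N ≤ stepLaw ℓ F μ B := by
  rw [stepLaw, Measure.map_apply hF hB, ← Measure.prod_prod]
  exact measure_mono fun z hz => hAB z.1 hz.1 z.2 hz.2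

end MarkovOperator

section Oscillation

variable {H : Type*} [MeasurableSpace H] {f : H → ℝ} {μ ν : Measure H} [IsProbabilityMeasure μ]
  [IsProbabilityMeasure ν]

theorem integral_sub_integral_eq_integral_prod (hμ : Integrable f μ) (hν : Integrable f ν) :
    ∫ x, f x ∂μ - ∫ x, f x ∂ν = ∫ z : H × H, (f z.1 - f z.2) ∂(μ.prod ν) := by
  rw [integral_sub (hμ.comp_fst ν) (hν.comp_snd μ), integral_fun_fst, integral_fun_snd]
  simp only [probReal_univ, one_smul]

theorem abs_integral_sub_integral_le_of_oscillation (hf : BoundedMeasurable f) {X B : Set H}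
    (hB : MeasurableSet B) {a p : ℝ} (ha : 0 ≤ a) (hp : 0 ≤ p)
    (hfX : ∀ x ∈ X, ∀ y ∈ X, |f x - f y| ≤ a)
    (hfB : ∀ x ∈ X ∩ B, ∀ y ∈ X ∩ B, |f x - f y| ≤ a / 2) (hμX : ∀ᵐ x ∂μ, x ∈ X)
    (hνX : ∀ᵐ x ∂ν, x ∈ X) (hμB : p ≤ μ.real B) (hνB : p ≤ ν.real B) :
    |∫ x, f x ∂μ - ∫ x, f x ∂ν| ≤ (1 - p ^ 2 / 2) * a := by
  rw [integral_sub_integral_eq_integral_prod (hf.integrable μ) (hf.integrable ν)]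
  have hgain : Integrable ((B ×ˢ B).indicator fun _ => a / 2) (μ.prod ν) :=
    (integrable_const _).indicator (hB.prod hB)
  have hbound : ∀ᵐ z ∂(μ.prod ν),
      ‖f z.1 - f z.2‖ ≤ a - (B ×ˢ B).indicator (fun _ => a / 2) z := by
    filter_upwards [Measure.quasiMeasurePreserving_fst.ae hμX,
      Measure.quasiMeasurePreserving_snd.ae hνX] with z hz hz'
    by_cases hzB : z ∈ B ×ˢ B
    · rw [Set.indicator_of_mem hzB, sub_half]
      exact hfB _ ⟨hz, hzB.1⟩ _ ⟨hz', hzB.2⟩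
    · rw [Set.indicator_of_notMem hzB, sub_zero]
      exact hfX _ hz _ hz'
  have hpB : p ^ 2 ≤ μ.real B * ν.real B := by
    rw [sq]
    exact mul_le_mul hμB hνB hp measureReal_nonneg
  calc |∫ z : H × H, (f z.1 - f z.2) ∂(μ.prod ν)|
      ≤ ∫ z, (a - (B ×ˢ B).indicator (fun _ => a / 2) z) ∂(μ.prod ν) :=
        norm_integral_le_of_norm_le ((integrable_const a).sub hgain) hbound
    _ = a - μ.real B * ν.real B * (a / 2) := by
        rw [integral_sub (integrable_const a) hgain,
          integral_indicator_const _ (hB.prod hB), measureReal_prod_prod, integral_const,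
          probReal_univ, one_smul, smul_eq_mul]
    _ ≤ (1 - p ^ 2 / 2) * a := by nlinarith

end Oscillation

section Coupling

variable {E : Type*} [MeasurableSpace E] {ℓ : Measure E} [IsProbabilityMeasure ℓ] {T : E → E}
  {ε : ℝ≥0} {K : Set E}

theorem AlmostPreserves.measureReal_preimage_compl_le (hT : AlmostPreserves ℓ T ε)
    (hK : MeasurableSet K) (hℓK : ∀ᵐ ζ ∂ℓ, ζ ∈ K) : ℓ.real (T ⁻¹' K)ᶜ ≤ ε := by
  have hK_one : ℓ.real K = 1 :=
    (measureReal_congr (eventuallyEq_univ.2 hℓK)).trans probReal_univ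
  rw [probReal_compl_eq_one_sub (hT.measurable hK)]
  linarith [hT.measureReal_le hK]

variable {g g' : E → ℝ} {a b : ℝ}

theorem AlmostPreserves.abs_integral_comp_sub_integral_le (hT : AlmostPreserves ℓ T ε)
    (hK : MeasurableSet K) (hℓK : ∀ᵐ ζ ∂ℓ, ζ ∈ K) (ha : 0 ≤ a) (hb : 0 ≤ b)
    (hgT : Integrable (fun ζ => g (T ζ)) ℓ) (hg' : Integrable g' ℓ) (hg0 : ∀ ζ ∉ K, g ζ = 0)
    (hg'a : ∀ ζ ∈ K, |g' ζ| ≤ a) (hgg' : ∀ ζ ∈ K, T ζ ∈ K → |g (T ζ) - g' ζ| ≤ b) :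
    |∫ ζ, g (T ζ) ∂ℓ - ∫ ζ, g' ζ ∂ℓ| ≤ b + a * ε := by
  have hTK : MeasurableSet (T ⁻¹' K)ᶜ := (hT.measurable hK).compl
  have hpay : Integrable ((T ⁻¹' K)ᶜ.indicator fun _ => a) ℓ := (integrable_const a).indicator hTK
  have hbound : ∀ᵐ ζ ∂ℓ, ‖g (T ζ) - g' ζ‖ ≤ b + (T ⁻¹' K)ᶜ.indicator (fun _ => a) ζ := by
    filter_upwards [hℓK] with ζ hζ
    by_cases hTζ : T ζ ∈ K
    · rw [Set.indicator_of_notMem (not_not_intro hTζ), add_zero]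
      exact hgg' ζ hζ hTζ
    · rw [Set.indicator_of_mem hTζ, hg0 _ hTζ, zero_sub, norm_neg]
      exact (hg'a ζ hζ).trans (le_add_of_nonneg_left hb)
  rw [← integral_sub hgT hg']
  calc |∫ ζ, (g (T ζ) - g' ζ) ∂ℓ|
      ≤ ∫ ζ, (b + (T ⁻¹' K)ᶜ.indicator (fun _ => a) ζ) ∂ℓ :=
        norm_integral_le_of_norm_le ((integrable_const b).add hpay) hbound
    _ = b + a * ℓ.real (T ⁻¹' K)ᶜ := by
        rw [integral_add (integrable_const b) hpay, integral_indicator_const _ hTK,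
          integral_const, probReal_univ, one_smul, smul_eq_mul, mul_comm]
    _ ≤ b + a * ε := by
        gcongr
        exact hT.measureReal_preimage_compl_le hK hℓK

/-- Coupling: the noise `ζ` of one chain is paired with the noise `T ζ` of the other. -/
theorem AlmostPreserves.abs_integral_sub_integral_le (hT : AlmostPreserves ℓ T ε)
    (hK : MeasurableSet K) (hℓK : ∀ᵐ ζ ∂ℓ, ζ ∈ K) (ha : 0 ≤ a) (hb : 0 ≤ b)
    (hg : Measurable g) (hg' : Integrable g' ℓ) (hga : ∀ ζ ∈ K, |g ζ| ≤ a)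
    (hg'a : ∀ ζ ∈ K, |g' ζ| ≤ a) (hgg' : ∀ ζ ∈ K, T ζ ∈ K → |g (T ζ) - g' ζ| ≤ b) :
    |∫ ζ, g ζ ∂ℓ - ∫ ζ, g' ζ ∂ℓ| ≤ b + 3 * a * ε := by
  have hmeas : Measurable (K.indicator g) := hg.indicator hK
  have habs : ∀ ζ, |K.indicator g ζ| ≤ a := fun ζ => by
    by_cases hζ : ζ ∈ K
    · rw [Set.indicator_of_mem hζ]
      exact hga ζ hζ
    · rwa [Set.indicator_of_notMem hζ, abs_zero]
  have hrestrict : ∫ ζ, g ζ ∂ℓ = ∫ ζ, K.indicator g ζ ∂ℓ :=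
    integral_congr_ae (hℓK.mono fun ζ hζ => (Set.indicator_of_mem hζ g).symm)
  have hdistortion := hT.abs_integral_sub_le hmeas habs
  have hcoupling := hT.abs_integral_comp_sub_integral_le hK hℓK ha hb
    (BoundedMeasurable.integrable ⟨hmeas.comp hT.measurable, a, fun ζ => habs (T ζ)⟩ ℓ) hg'
    (fun ζ hζ => Set.indicator_of_notMem hζ g) hg'a fun ζ hζ hTζ => by
      rw [Set.indicator_of_mem hTζ]
      exact hgg' ζ hζ hTζ
  rw [hrestrict]
  refine (abs_sub_le _ _ _).trans ((add_le_add hdistortion hcoupling).trans_eq ?_)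
  ring

end Coupling

section LocalContraction

/-- `f` is `a`-Lipschitz on `X` for the truncated distance `min 1 (‖x - y‖ / δ)`. -/
def TruncLipschitzOn {H : Type*} [NormedAddCommGroup H] (δ a : ℝ) (X : Set H) (f : H → ℝ) : Prop :=
  ∀ x ∈ X, ∀ y ∈ X, |f x - f y| ≤ a * min 1 (‖x - y‖ / δ)

theorem TruncLipschitzOn.abs_sub_le {H : Type*} [NormedAddCommGroup H] {δ a : ℝ} {X : Set H}
    {f : H → ℝ} (ha : 0 ≤ a) (hf : TruncLipschitzOn δ a X f) {x y : H}
    (hx : x ∈ X) (hy : y ∈ X) : |f x - f y| ≤ a :=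
  (hf x hx y hy).trans (mul_le_of_le_one_right ha (min_le_left _ _))

/-- The setting in which the Markov operator contracts at small scales on `X`: the noise lives in
`K` and keeps the chain in `X`, and `Halving` holds at the scale `δ`. The smallness of `C * δ`
guarantees that the gain in `Halving` exceeds the cost of distorting the law of the noise. -/
structure ContractsLocally {H E : Type*} [NormedAddCommGroup H] [MeasurableSpace H]
    [MeasurableSpace E] (ℓ : Measure E) (F : H × E → H) (K : Set E) (X : Set H) (δ : ℝ)
    (C : ℝ≥0) : Prop where
  measurable : Measurable F
  measurableSet_noise : MeasurableSet K
  ae_mem_noise : ∀ᵐ ζ ∂ℓ, ζ ∈ K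
  measurableSet : MeasurableSet X
  invariant : ∀ u ∈ X, ∀ ζ ∈ K, F (u, ζ) ∈ X
  scale_pos : 0 < δ
  distortion_le : 12 * C * δ ≤ 1
  halving : Halving ℓ F K X δ C

namespace ContractsLocally

variable {H E : Type*} [NormedAddCommGroup H] [MeasurableSpace H] [MeasurableSpace E]
  {ℓ : Measure E} {F : H × E → H} {K : Set E} {X : Set H} {δ : ℝ}
  {C : ℝ≥0} {f : H → ℝ} {a : ℝ} {x y : H}

theorem ae_mem_iterate_stepLaw_dirac (h : ContractsLocally ℓ F K X δ C) (hx : x ∈ X) (k : ℕ) :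
    ∀ᵐ y ∂(stepLaw ℓ F)^[k] (Measure.dirac x), y ∈ X :=
  ae_mem_iterate_stepLaw h.measurable ((ae_dirac_iff h.measurableSet).2 hx) h.ae_mem_noise
    h.measurableSet h.invariant k

variable [IsProbabilityMeasure ℓ]

theorem integrable_comp (h : ContractsLocally ℓ F K X δ C) (hf : BoundedMeasurable f) (v : H) :
    Integrable (fun ζ => f (F (v, ζ))) ℓ :=
  (hf.comp (h.measurable.comp measurable_prodMk_left)).integrable ℓ

theorem markovOp_sub_const (h : ContractsLocally ℓ F K X δ C) (hf : BoundedMeasurable f) (v : H)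
    (c : ℝ) : markovOp ℓ F f v - c = ∫ ζ, (f (F (v, ζ)) - c) ∂ℓ := by
  rw [integral_sub (h.integrable_comp hf v) (integrable_const c), integral_const, probReal_univ,
    one_smul]
  rfl

theorem abs_markovOp_sub_le_of_norm_sub_le (h : ContractsLocally ℓ F K X δ C) (ha : 0 ≤ a)
    (hfm : BoundedMeasurable f) (hf : TruncLipschitzOn δ a X f) (hx : x ∈ X) (hy : y ∈ X)
    (hxy : ‖x - y‖ ≤ δ) :
    |markovOp ℓ F f x - markovOp ℓ F f y| ≤ 3 / 4 * a * (‖x - y‖ / δ) := by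
  obtain ⟨Ψ, hΨ, hΨK⟩ := h.halving y hy x hx hxy
  have hδ := h.scale_pos
  have hcoupled := hΨ.abs_integral_sub_integral_le (g := fun ζ => f (F (x, ζ)) - f y)
    (g' := fun ζ => f (F (y, ζ)) - f y) (b := a * (‖x - y‖ / 2 / δ))
    h.measurableSet_noise h.ae_mem_noise ha (by positivity)
    ((hfm.measurable.comp (h.measurable.comp measurable_prodMk_left)).sub_const _)
    ((h.integrable_comp hfm y).sub (integrable_const _))
    (fun ζ hζ => hf.abs_sub_le ha (h.invariant x hx ζ hζ) hy)
    (fun ζ hζ => hf.abs_sub_le ha (h.invariant y hy ζ hζ) hy) fun ζ hζ hΨζ => by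
      rw [sub_sub_sub_cancel_right]
      refine (hf _ (h.invariant x hx _ hΨζ) _ (h.invariant y hy ζ hζ)).trans ?_
      gcongr
      refine (min_le_right _ _).trans ?_
      gcongr
      exact hΨK ζ hζ
  rw [← h.markovOp_sub_const hfm, ← h.markovOp_sub_const hfm, sub_sub_sub_cancel_right] at hcoupled
  have hcost : C * ‖x - y‖ ≤ ‖x - y‖ / δ / 12 := by
    rw [le_div_iff₀ (by norm_num), le_div_iff₀ hδ]
    nlinarith [h.distortion_le, norm_nonneg (x - y)]
  refine hcoupled.trans ?_
  push_cast
  rw [div_right_comm]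
  nlinarith [mul_le_mul_of_nonneg_left hcost ha]

theorem truncLipschitzOn_markovOp (h : ContractsLocally ℓ F K X δ C) (ha : 0 ≤ a)
    (hfm : BoundedMeasurable f) (hf : TruncLipschitzOn δ a X f) :
    TruncLipschitzOn δ a X (markovOp ℓ F f) := by
  intro x hx y hy
  have hδ := h.scale_pos
  rcases le_or_gt ‖x - y‖ δ with hxy | hxy
  · rw [min_eq_right ((div_le_one hδ).2 hxy)]
    refine (h.abs_markovOp_sub_le_of_norm_sub_le ha hfm hf hx hy hxy).trans ?_
    gcongr
    linarith
  · rw [min_eq_left ((one_le_div hδ).2 hxy.le)]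
    unfold markovOp
    rw [← integral_sub (h.integrable_comp hfm x) (h.integrable_comp hfm y)]
    refine (norm_integral_le_of_norm_le_const (f := fun ζ => f (F (x, ζ)) - f (F (y, ζ)))
      (h.ae_mem_noise.mono fun ζ hζ =>
        hf.abs_sub_le ha (h.invariant x hx ζ hζ) (h.invariant y hy ζ hζ))).trans_eq ?_
    rw [probReal_univ]

theorem truncLipschitzOn_iterate_markovOp (h : ContractsLocally ℓ F K X δ C) (ha : 0 ≤ a)
    (hfm : BoundedMeasurable f) (hf : TruncLipschitzOn δ a X f) (k : ℕ) :
    TruncLipschitzOn δ a X ((markovOp ℓ F)^[k] f) := by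
  induction k with
  | zero => exact hf
  | succ k ih =>
    rw [Function.iterate_succ_apply']
    exact h.truncLipschitzOn_markovOp ha (hfm.iterate_markovOp h.measurable k) ih

/-- A weak form of Harris' theorem: nearby points are handled by the local contraction, distant
ones by a simultaneous visit of both chains to a small ball. -/
theorem truncLipschitzOn_iterate_markovOp_of_visit [BorelSpace H]
    (h : ContractsLocally ℓ F K X δ C) {m : ℕ} {p : ℝ} (hp : 0 ≤ p)
    (hvisit : ∀ u ∈ X, p ≤
      ((stepLaw ℓ F)^[m + 1] (Measure.dirac u)).real (Metric.closedBall 0 (δ / 4)))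
    (ha : 0 ≤ a) (hfm : BoundedMeasurable f) (hf : TruncLipschitzOn δ a X f) :
    TruncLipschitzOn δ (max (3 / 4) (1 - p ^ 2 / 2) * a) X ((markovOp ℓ F)^[m + 1] f) := by
  intro x hx y hy
  have hδ := h.scale_pos
  rcases le_or_gt ‖x - y‖ δ with hxy | hxy
  · rw [Function.iterate_succ_apply', min_eq_right ((div_le_one hδ).2 hxy)]
    refine (h.abs_markovOp_sub_le_of_norm_sub_le ha (hfm.iterate_markovOp h.measurable m)
      (h.truncLipschitzOn_iterate_markovOp ha hfm hf m) hx hy hxy).trans ?_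
    gcongr
    exact le_max_left _ _
  · have hball : ∀ z ∈ X ∩ Metric.closedBall 0 (δ / 4), ∀ w ∈ X ∩ Metric.closedBall 0 (δ / 4),
        |f z - f w| ≤ a / 2 := fun z hz w hw => by
      refine (hf z hz.1 w hw.1).trans (mul_le_mul_of_nonneg_left (b := _) (c := 2⁻¹) ?_ ha)
      refine (min_le_right _ _).trans ((div_le_iff₀ hδ).2 ((norm_sub_le z w).trans ?_))
      linarith [mem_closedBall_zero_iff.1 hz.2, mem_closedBall_zero_iff.1 hw.2]
    have := isProbabilityMeasure_iterate_stepLaw (ℓ := ℓ) h.measurable (Measure.dirac x) (m + 1)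
    have := isProbabilityMeasure_iterate_stepLaw (ℓ := ℓ) h.measurable (Measure.dirac y) (m + 1)
    rw [min_eq_left ((one_le_div hδ).2 hxy.le), mul_one,
      iterate_markovOp_eq_integral h.measurable hfm, iterate_markovOp_eq_integral h.measurable hfm]
    refine (abs_integral_sub_integral_le_of_oscillation hfm measurableSet_closedBall ha hp
      (fun z hz w hw => hf.abs_sub_le ha hz hw) hball (h.ae_mem_iterate_stepLaw_dirac hx _)
      (h.ae_mem_iterate_stepLaw_dirac hy _) (hvisit x hx) (hvisit y hy)).trans ?_
    gcongr
    exact le_max_right _ _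

end ContractsLocally

end LocalContraction

section Visits

variable {H E : Type*} [NormedAddCommGroup H] {F : H × E → H} {γ R : ℝ}

theorem eventually_norm_le_mul_add [NormedAddCommGroup E]
    (hF : ∀ B : Set (H × E), Bornology.IsBounded B → ∃ L : ℝ≥0, LipschitzOnWith L F B)
    (hγ : ∀ u, ‖F (u, 0)‖ ≤ γ * ‖u‖) (R : ℝ) {ε : ℝ} (hε : 0 < ε) :
    ∀ᶠ ζ in 𝓝 (0 : E), ∀ u, ‖u‖ ≤ R → ‖F (u, ζ)‖ ≤ γ * ‖u‖ + ε := by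
  obtain ⟨L, hL⟩ := hF (Metric.closedBall 0 R ×ˢ Metric.closedBall 0 1)
    (Metric.isBounded_closedBall.prod Metric.isBounded_closedBall)
  have hsmall : ∀ᶠ ζ in 𝓝 (0 : E), L * ‖ζ‖ < ε :=
    (by fun_prop : Continuous fun ζ : E => L * ‖ζ‖).continuousAt.eventually_lt_const (by simpa)
  filter_upwards [hsmall, Metric.closedBall_mem_nhds 0 one_pos] with ζ hζ hζ_mem u hu
  have hu_mem : u ∈ Metric.closedBall 0 R := mem_closedBall_zero_iff.2 hu
  have hdist := hL.dist_le_mul (u, ζ) ⟨hu_mem, hζ_mem⟩ (u, 0)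
    ⟨hu_mem, Metric.mem_closedBall_self zero_le_one⟩
  rw [dist_prod_same_left, dist_zero_right, dist_eq_norm] at hdist
  linarith [norm_le_norm_add_norm_sub' (F (u, ζ)) (F (u, 0)), hγ u]

variable [MeasurableSpace H] [BorelSpace H] [MeasurableSpace E] {ℓ : Measure E}
  [IsProbabilityMeasure ℓ]

theorem pow_le_iterate_stepLaw_closedBall (hFm : Measurable F) (hγ0 : 0 ≤ γ) (hγ1 : γ ≤ 1)
    {ρ : ℝ} (hρ : ρ ≤ R) {N : Set E}
    (hN : ∀ ζ ∈ N, ∀ u, ‖u‖ ≤ R → ‖F (u, ζ)‖ ≤ γ * ‖u‖ + (1 - γ) * ρ) {u : H} (hu : ‖u‖ ≤ R)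
    (k : ℕ) : ℓ N ^ k ≤ (stepLaw ℓ F)^[k] (Measure.dirac u)
      (Metric.closedBall 0 (ρ + γ ^ k * (R - ρ))) := by
  induction k with
  | zero =>
    have hmem : u ∈ Metric.closedBall (0 : H) R := mem_closedBall_zero_iff.2 hu
    simp [hmem]
  | succ k ih =>
    rw [Function.iterate_succ_apply', pow_succ]
    refine le_trans (by gcongr) (mul_le_stepLaw hFm _ measurableSet_closedBall
      (A := Metric.closedBall 0 (ρ + γ ^ k * (R - ρ))) fun v hv ζ hζ => ?_)
    rw [mem_closedBall_zero_iff] at hv ⊢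
    have hvR : ‖v‖ ≤ R := by
      nlinarith [pow_le_one₀ hγ0 hγ1 (n := k), pow_nonneg hγ0 k]
    calc ‖F (v, ζ)‖ ≤ γ * ‖v‖ + (1 - γ) * ρ := hN ζ hζ v hvR
      _ ≤ γ * (ρ + γ ^ k * (R - ρ)) + (1 - γ) * ρ := by gcongr
      _ = ρ + γ ^ (k + 1) * (R - ρ) := by ring

theorem exists_forall_le_iterate_stepLaw_closedBall [NormedAddCommGroup E] (hFm : Measurable F)
    (hF : ∀ B : Set (H × E), Bornology.IsBounded B → ∃ L : ℝ≥0, LipschitzOnWith L F B)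
    (h0 : (0 : E) ∈ ℓ.support) (hγ0 : 0 < γ) (hγ1 : γ < 1) (hγ : ∀ u, ‖F (u, 0)‖ ≤ γ * ‖u‖)
    (hR : 0 < R) {τ : ℝ} (hτ : 0 < τ) :
    ∃ (m : ℕ) (p : ℝ), 0 < p ∧ ∀ u : H, ‖u‖ ≤ R →
      p ≤ ((stepLaw ℓ F)^[m + 1] (Measure.dirac u)).real (Metric.closedBall 0 τ) := by
  set ρ := min R (τ / 2)
  have hρ : 0 < ρ := by positivity
  set N := {ζ : E | ∀ u, ‖u‖ ≤ R → ‖F (u, ζ)‖ ≤ γ * ‖u‖ + (1 - γ) * ρ}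
  have hN : 0 < ℓ N := (Measure.mem_support_iff_forall _).1 h0 N
    (eventually_norm_le_mul_add hF hγ R (mul_pos (sub_pos.2 hγ1) hρ))
  obtain ⟨m, hm⟩ := exists_pow_lt_of_lt_one (show 0 < τ / 2 / R by positivity) hγ1
  refine ⟨m, ℓ.real N ^ (m + 1), pow_pos (ENNReal.toReal_pos hN.ne' (measure_ne_top _ _)) _,
    fun u hu => ?_⟩
  have hradius : ρ + γ ^ (m + 1) * (R - ρ) ≤ τ := by
    have hpow : γ ^ (m + 1) ≤ γ ^ m := pow_le_pow_of_le_one hγ0.le hγ1.le m.le_succ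
    rw [lt_div_iff₀ hR] at hm
    nlinarith [min_le_right R (τ / 2), pow_pos hγ0 (m + 1)]
  have := isProbabilityMeasure_iterate_stepLaw (ℓ := ℓ) hFm (Measure.dirac u) (m + 1)
  rw [measureReal_def, ← ENNReal.toReal_pow]
  exact ENNReal.toReal_mono (measure_ne_top _ _)
    ((pow_le_iterate_stepLaw_closedBall hFm hγ0.le hγ1.le (min_le_left _ _) (fun ζ hζ => hζ) hu
      (m + 1)).trans (measure_mono (Metric.closedBall_subset_closedBall hradius)))

end Visits

section LipDualDist

variable {X : Type*} [MeasurableSpace X] {μ ν : Measure X}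

theorem abs_integral_sub_integral_le_two [IsProbabilityMeasure μ]
    [IsProbabilityMeasure ν] {f : X → ℝ} (hf : ∀ x, |f x| ≤ 1) :
    |∫ x, f x ∂μ - ∫ x, f x ∂ν| ≤ 2 := by
  have hle : ∀ (ρ : Measure X) [IsProbabilityMeasure ρ], |∫ x, f x ∂ρ| ≤ 1 := fun ρ _ =>
    (norm_integral_le_of_norm_le_const (f := f) (.of_forall hf)).trans_eq
      (by rw [probReal_univ, mul_one])
  exact (abs_sub _ _).trans (by linarith [hle μ, hle ν])

variable [PseudoMetricSpace X]

theorem lipDualDist_le {r : ℝ} (h : ∀ f : X → ℝ, (∀ x, |f x| ≤ 1) → LipschitzWith 1 f →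
    |∫ x, f x ∂μ - ∫ x, f x ∂ν| ≤ r) : lipDualDist μ ν ≤ r := by
  refine csSup_le ⟨_, 0, by simp, LipschitzWith.const' 0, rfl⟩ ?_
  rintro _ ⟨f, hf, hfl, rfl⟩
  exact h f hf hfl

theorem abs_integral_sub_integral_le_lipDualDist [IsProbabilityMeasure μ]
    [IsProbabilityMeasure ν] {f : X → ℝ} (hf : ∀ x, |f x| ≤ 1)
    (hfl : LipschitzWith 1 f) : |∫ x, f x ∂μ - ∫ x, f x ∂ν| ≤ lipDualDist μ ν :=
  le_csSup ⟨2, by rintro _ ⟨g, hg, -, rfl⟩; exact abs_integral_sub_integral_le_two hg⟩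
    ⟨f, hf, hfl, rfl⟩

end LipDualDist

section Mixing

theorem exists_pow_div_le_mul_pow {α : ℝ} (hα0 : 0 < α) (hα1 : α < 1) (m : ℕ) :
    ∃ κ : ℝ, 0 < κ ∧ κ < 1 ∧ ∀ k : ℕ, α ^ (k / (m + 1)) ≤ α⁻¹ * κ ^ k := by
  set κ : ℝ := α ^ (((m + 1 : ℕ) : ℝ)⁻¹)
  have hκ_pow : κ ^ (m + 1) = α := Real.rpow_inv_natCast_pow hα0.le m.succ_ne_zero
  have hκ0 : 0 < κ := Real.rpow_pos_of_pos hα0 _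
  have hκ1 : κ < 1 := Real.rpow_lt_one hα0.le hα1 (by positivity)
  refine ⟨κ, hκ0, hκ1, fun k => ?_⟩
  rw [le_inv_mul_iff₀ hα0, ← pow_succ', ← hκ_pow, ← pow_mul]
  exact pow_le_pow_of_le_one hκ0.le hκ1.le (Nat.lt_mul_div_succ k m.succ_pos).le

/-- Exponential mixing on `X` in the Lipschitz-dual distance: the initial law is forgotten at an
exponential rate which is uniform over the laws carried by `X`. -/
def MixesExponentiallyOn {H E : Type*} [PseudoMetricSpace H] [MeasurableSpace H]
    [MeasurableSpace E] (ℓ : Measure E) (F : H × E → H) (X : Set H) : Prop :=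
  ∃ A κ : ℝ, 0 < A ∧ 0 < κ ∧ κ < 1 ∧ ∀ (μ ν : Measure H) [IsProbabilityMeasure μ]
    [IsProbabilityMeasure ν], (∀ᵐ x ∂μ, x ∈ X) → (∀ᵐ x ∂ν, x ∈ X) →
      ∀ k, lipDualDist ((stepLaw ℓ F)^[k] μ) ((stepLaw ℓ F)^[k] ν) ≤ A * κ ^ k

theorem truncLipschitzOn_of_lipschitzWith {H : Type*} [NormedAddCommGroup H] {f : H → ℝ}
    (hf : ∀ x, |f x| ≤ 1) (hfl : LipschitzWith 1 f) {δ : ℝ} (hδ0 : 0 < δ) (hδ1 : δ ≤ 1)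
    (X : Set H) : TruncLipschitzOn δ 2 X f := by
  intro x _ y _
  have hbound : |f x - f y| ≤ 2 := (abs_sub _ _).trans (by linarith [hf x, hf y])
  have hlip : |f x - f y| ≤ ‖x - y‖ := by
    simpa only [NNReal.coe_one, one_mul, Real.dist_eq, dist_eq_norm x y] using hfl.dist_le_mul x y
  have hscale : ‖x - y‖ ≤ ‖x - y‖ / δ := le_div_self (norm_nonneg _) hδ0 hδ1
  rcases le_total 1 (‖x - y‖ / δ) with hfar | hnear
  · rwa [min_eq_left hfar, mul_one]
  · rw [min_eq_right hnear]
    linarith [norm_nonneg (x - y)]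

variable {H E : Type*} [NormedAddCommGroup H] [MeasurableSpace H] [MeasurableSpace E]
  {ℓ : Measure E} [IsProbabilityMeasure ℓ] {F : H × E → H} {K : Set E} {X : Set H}

theorem MixesExponentiallyOn.of_mapsTo (hX : MixesExponentiallyOn ℓ F X) (hF : Measurable F)
    (hXm : MeasurableSet X) (hK : ∀ᵐ ζ ∂ℓ, ζ ∈ K) {B : Set H}
    (hBX : ∀ u ∈ B, ∀ ζ ∈ K, F (u, ζ) ∈ X) : MixesExponentiallyOn ℓ F B := by
  obtain ⟨A, κ, hA, hκ0, hκ1, hmix⟩ := hX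
  refine ⟨max 2 (A / κ), κ, by positivity, hκ0, hκ1, fun μ ν _ _ hμ hν k => ?_⟩
  cases k with
  | zero =>
    rw [pow_zero, mul_one, Function.iterate_zero, id, id]
    exact (lipDualDist_le fun f hf _ => abs_integral_sub_integral_le_two hf).trans
      (le_max_left _ _)
  | succ k =>
    have := isProbabilityMeasure_stepLaw (ℓ := ℓ) hF μ
    have := isProbabilityMeasure_stepLaw (ℓ := ℓ) hF ν
    rw [Function.iterate_succ_apply, Function.iterate_succ_apply]
    calc lipDualDist ((stepLaw ℓ F)^[k] (stepLaw ℓ F μ)) ((stepLaw ℓ F)^[k] (stepLaw ℓ F ν))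
        ≤ A * κ ^ k := hmix _ _ (ae_mem_stepLaw hF hμ hK hXm hBX)
          (ae_mem_stepLaw hF hν hK hXm hBX) k
      _ = A / κ * κ ^ (k + 1) := by rw [pow_succ]; field_simp
      _ ≤ max 2 (A / κ) * κ ^ (k + 1) := by gcongr; exact le_max_right _ _

variable [BorelSpace H] {δ : ℝ} {C : ℝ≥0} {f : H → ℝ} {a p : ℝ} {m : ℕ}

theorem ContractsLocally.truncLipschitzOn_iterate_markovOp_mul (h : ContractsLocally ℓ F K X δ C)
    (hp : 0 ≤ p) (hvisit : ∀ u ∈ X, p ≤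
      ((stepLaw ℓ F)^[m + 1] (Measure.dirac u)).real (Metric.closedBall 0 (δ / 4)))
    (ha : 0 ≤ a) (hfm : BoundedMeasurable f) (hf : TruncLipschitzOn δ a X f) (n : ℕ) :
    TruncLipschitzOn δ (max (3 / 4) (1 - p ^ 2 / 2) ^ n * a) X
      ((markovOp ℓ F)^[(m + 1) * n] f) := by
  induction n with
  | zero => simpa using hf
  | succ n ih =>
    rw [mul_add_one (m + 1) n, add_comm _ (m + 1), Function.iterate_add_apply,
      pow_succ' (max _ _) n, mul_assoc (max _ _)]
    exact h.truncLipschitzOn_iterate_markovOp_of_visit hp hvisit (by positivity)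
      (hfm.iterate_markovOp h.measurable _) ih

theorem ContractsLocally.truncLipschitzOn_iterate_markovOp_div (h : ContractsLocally ℓ F K X δ C)
    (hp : 0 ≤ p) (hvisit : ∀ u ∈ X, p ≤
      ((stepLaw ℓ F)^[m + 1] (Measure.dirac u)).real (Metric.closedBall 0 (δ / 4)))
    (ha : 0 ≤ a) (hfm : BoundedMeasurable f) (hf : TruncLipschitzOn δ a X f) (k : ℕ) :
    TruncLipschitzOn δ (max (3 / 4) (1 - p ^ 2 / 2) ^ (k / (m + 1)) * a) X
      ((markovOp ℓ F)^[k] f) := by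
  have hsplit : (markovOp ℓ F)^[k] f =
      (markovOp ℓ F)^[k % (m + 1)] ((markovOp ℓ F)^[(m + 1) * (k / (m + 1))] f) := by
    rw [← Function.iterate_add_apply, Nat.mod_add_div]
  rw [hsplit]
  exact h.truncLipschitzOn_iterate_markovOp (by positivity) (hfm.iterate_markovOp h.measurable _)
    (h.truncLipschitzOn_iterate_markovOp_mul hp hvisit ha hfm hf _) _

theorem ContractsLocally.mixesExponentiallyOn (h : ContractsLocally ℓ F K X δ C) (hδ : δ ≤ 1)
    (hp : 0 < p) (hvisit : ∀ u ∈ X, p ≤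
      ((stepLaw ℓ F)^[m + 1] (Measure.dirac u)).real (Metric.closedBall 0 (δ / 4))) :
    MixesExponentiallyOn ℓ F X := by
  set α : ℝ := max (3 / 4) (1 - p ^ 2 / 2)
  have hα0 : 0 < α := lt_max_of_lt_left (by norm_num)
  have hα1 : α < 1 := max_lt (by norm_num) (by linarith [pow_pos hp 2])
  obtain ⟨κ, hκ0, hκ1, hκ⟩ := exists_pow_div_le_mul_pow hα0 hα1 m
  refine ⟨α⁻¹ * 2, κ, by positivity, hκ0, hκ1, fun μ ν _ _ hμX hνX k => ?_⟩
  refine lipDualDist_le fun f hf hfl => ?_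
  have hfm : BoundedMeasurable f := ⟨hfl.continuous.measurable, 1, hf⟩
  have hlip := h.truncLipschitzOn_iterate_markovOp_div hp.le hvisit zero_le_two hfm
    (truncLipschitzOn_of_lipschitzWith hf hfl h.scale_pos hδ X) k
  have hosc := abs_integral_sub_integral_le_of_oscillation
    (hfm.iterate_markovOp (ℓ := ℓ) h.measurable k) MeasurableSet.empty (p := 0) (by positivity)
    le_rfl (fun x hx y hy => hlip.abs_sub_le (by positivity) hx hy)
    (fun x hx => absurd hx.2 (Set.notMem_empty x)) hμX hνX measureReal_nonneg measureReal_nonneg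
  rw [integral_iterate_stepLaw h.measurable hfm, integral_iterate_stepLaw h.measurable hfm]
  linarith [hκ k]

end Mixing

section BallMixing

variable {ι H E V : Type*} [NormedAddCommGroup H] [InnerProductSpace ℝ H]
  [NormedAddCommGroup E] [InnerProductSpace ℝ E] [NormedAddCommGroup V] [NormedSpace ℝ V]
  {emb : V →L[ℝ] H} {S : H × E → V} {γ β R : ℝ} {K : Set E}

theorem Dissipative.exists_isCompact (hD : Dissipative (fun z => emb (S z)) K γ β)
    (hemb : IsCompactOperator emb) (hS : Regular S) (hK : Bornology.IsBounded K)
    (hR : β / (1 - γ) ≤ R) : ∃ X : Set H, IsCompact X ∧ X ⊆ Metric.closedBall 0 R ∧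
      ∀ u ∈ Metric.closedBall 0 R, ∀ ζ ∈ K, emb (S (u, ζ)) ∈ X := by
  refine ⟨closure (emb '' (S '' (Metric.closedBall 0 R ×ˢ K))), ?_, ?_, fun u hu ζ hζ =>
    subset_closure ⟨_, ⟨(u, ζ), ⟨hu, hζ⟩, rfl⟩, rfl⟩⟩
  · exact hemb.isCompact_closure_image_of_bounded (f := (emb : V →ₗ[ℝ] H))
      (hS.isBounded_image (Metric.isBounded_closedBall.prod hK))
  · refine closure_minimal ?_ Metric.isClosed_closedBall
    rintro _ ⟨_, ⟨⟨u, ζ⟩, ⟨hu, hζ⟩, rfl⟩, rfl⟩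
    rw [div_le_iff₀ (sub_pos.2 hD.gamma_lt_one)] at hR
    rw [mem_closedBall_zero_iff] at hu ⊢
    nlinarith [hD.bound u ζ hζ, hD.gamma_pos]

variable [MeasurableSpace H] [BorelSpace H] [MeasurableSpace E] [BorelSpace E] {ℓ : Measure E}
  {e : ι → E} {X : Set H}

theorem NonDegenerate.exists_contractsLocally (hN : NonDegenerate emb S K) (he : Orthonormal ℝ e)
    (hdense : Dense (Submodule.span ℝ (Set.range e) : Set E)) (hemb : IsCompactOperator emb)
    (hS : Regular S) (hm : Measurable fun z => emb (S z)) (hs : ∀ j, ShearStable ℓ (e j))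
    (hK : IsCompact K) (hℓK : ∀ᵐ ζ ∂ℓ, ζ ∈ K) (hX : IsCompact X)
    (hinv : ∀ u ∈ X, ∀ ζ ∈ K, emb (S (u, ζ)) ∈ X) :
    ∃ δ ≤ 1, ∃ C, ContractsLocally ℓ (fun z => emb (S z)) K X δ C := by
  obtain ⟨δ₀, hδ₀, C, hhalving⟩ := hN.exists_halving he hdense hemb hS hs hK hX
  set δ := min δ₀ (min 1 (1 / (12 * C + 1)))
  have hCδ : 12 * C * δ ≤ 1 := by
    have hδ : 0 < δ := by positivity
    have hle : δ ≤ 1 / (12 * C + 1) := (min_le_right _ _).trans (min_le_right _ _)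
    rw [le_div_iff₀ (by positivity)] at hle
    linarith
  exact ⟨δ, (min_le_right _ _).trans (min_le_left _ _), C, hm, hK.measurableSet, hℓK,
    hX.measurableSet, hinv, by positivity, hCδ, hhalving δ (min_le_left _ _)⟩

theorem NonDegenerate.mixesExponentiallyOn_closedBall [IsProbabilityMeasure ℓ]
    (hN : NonDegenerate emb S K) (he : Orthonormal ℝ e)
    (hdense : Dense (Submodule.span ℝ (Set.range e) : Set E)) (hemb : IsCompactOperator emb)
    (hS : Regular S) (hm : Measurable fun z => emb (S z)) (hs : ∀ j, ShearStable ℓ (e j))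
    (hK : IsCompact K) (hℓK : ∀ᵐ ζ ∂ℓ, ζ ∈ K) (h0 : (0 : E) ∈ ℓ.support)
    (hD : Dissipative (fun z => emb (S z)) K γ β) (hR : β / (1 - γ) ≤ R) :
    MixesExponentiallyOn ℓ (fun z => emb (S z)) (Metric.closedBall 0 R) := by
  obtain ⟨X, hX, hXR, hRX⟩ := hD.exists_isCompact hemb hS hK.isBounded hR
  obtain ⟨δ, hδ, C, hcontr⟩ := hN.exists_contractsLocally he hdense hemb hS hm hs hK hℓK hX
    fun u hu => hRX u (hXR hu)
  have hR0 : 0 < R := (div_pos hD.beta_pos (sub_pos.2 hD.gamma_lt_one)).trans_le hR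
  obtain ⟨m, p, hp, hvisit⟩ := exists_forall_le_iterate_stepLaw_closedBall hm
    (fun B hB => (hS.exists_lipschitzOnWith hB).imp' _ fun _ => emb.lipschitz.comp_lipschitzOnWith)
    h0 hD.gamma_pos hD.gamma_lt_one hD.bound_zero hR0 (τ := δ / 4)
    (by linarith [hcontr.scale_pos])
  exact (hcontr.mixesExponentiallyOn hδ hp fun u hu =>
    hvisit u (mem_closedBall_zero_iff.1 (hXR hu))).of_mapsTo hm hX.measurableSet hℓK hRX

end BallMixing

section WeakConvergence

variable {X : Type*} [MeasurableSpace X]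

theorem WeaklyConverges.unique [TopologicalSpace X] [HasOuterApproxClosed X] [BorelSpace X]
    {μs : ℕ → Measure X} {μ ν : Measure X} [IsFiniteMeasure μ] [IsFiniteMeasure ν]
    (hμ : WeaklyConverges μs μ) (hν : WeaklyConverges μs ν) : μ = ν :=
  ext_of_forall_integral_eq_of_IsFiniteMeasure fun f => tendsto_nhds_unique (hμ f) (hν f)

theorem exists_subseq_weaklyConverges_of_isCompact [TopologicalSpace X]
    [TopologicalSpace.MetrizableSpace X] [SecondCountableTopology X] [BorelSpace X]
    {μs : ℕ → Measure X} [hμs : ∀ k, IsProbabilityMeasure (μs k)] {K : Set X} (hK : IsCompact K)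
    (hμK : ∀ k, ∀ᵐ x ∂μs k, x ∈ K) :
    ∃ (μ : Measure X) (φ : ℕ → ℕ), IsProbabilityMeasure μ ∧ StrictMono φ ∧
      WeaklyConverges (fun k => μs (φ k)) μ ∧ ∀ᵐ x ∂μ, x ∈ K := by
  let Ps : ℕ → ProbabilityMeasure X := fun k => ⟨μs k, hμs k⟩
  have htight : IsTightMeasureSet {(P : Measure X) | P ∈ Set.range Ps} := by
    refine isTightMeasureSet_iff_exists_isCompact_measure_compl_le.2 fun ε _ => ⟨K, hK, ?_⟩
    rintro _ ⟨_, ⟨k, rfl⟩, rfl⟩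
    exact (mem_ae_iff.1 (hμK k)).trans_le zero_le
  obtain ⟨P, -, φ, hφ, hlim⟩ := (isCompact_closure_of_isTightMeasureSet htight).tendsto_subseq
    (x := Ps) fun k => subset_closure ⟨k, rfl⟩
  refine ⟨P, φ, P.2, hφ, ProbabilityMeasure.tendsto_iff_forall_integral_tendsto.1 hlim, ?_⟩
  have hfull : ∀ k, ((Ps ∘ φ) k : Measure X) K = 1 := fun k =>
    (prob_compl_eq_zero_iff hK.measurableSet).1 (mem_ae_iff.1 (hμK (φ k)))
  have hlimsup := ProbabilityMeasure.limsup_measure_closed_le_of_tendsto hlim hK.isClosed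
  simp only [hfull, limsup_const] at hlimsup
  exact mem_ae_iff.2 ((prob_compl_eq_zero_iff hK.measurableSet).2
    (le_antisymm prob_le_one hlimsup))

end WeakConvergence

section LipDualConvergence

variable {X : Type*} [PseudoMetricSpace X]

theorem exists_abs_le_and_lipschitzWith [Nonempty X] {f : X → ℝ}
    (hb : ∃ C, ∀ x y, dist (f x) (f y) ≤ C) (hl : ∃ L, LipschitzWith L f) :
    ∃ s : ℝ≥0, 0 < s ∧ (∀ x, |f x| ≤ s) ∧ LipschitzWith s f := by
  obtain ⟨C, hC⟩ := hb
  obtain ⟨L, hL⟩ := hl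
  obtain ⟨x₀⟩ := ‹Nonempty X›
  refine ⟨L + (|f x₀| + C).toNNReal + 1, by positivity, fun x => ?_,
    hL.weaken (by rw [add_assoc]; exact le_self_add)⟩
  have hdist : |f x - f x₀| ≤ C := hC x x₀
  push_cast
  linarith [abs_sub_abs_le_abs_sub (f x) (f x₀), Real.le_coe_toNNReal (|f x₀| + C), L.2]

variable [MeasurableSpace X]

theorem abs_integral_sub_integral_le_mul_lipDualDist {μ ν : Measure X} [IsProbabilityMeasure μ]
    [IsProbabilityMeasure ν] {f : X → ℝ} {s : ℝ≥0} (hs : 0 < s) (hf : ∀ x, |f x| ≤ s)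
    (hfl : LipschitzWith s f) : |∫ x, f x ∂μ - ∫ x, f x ∂ν| ≤ s * lipDualDist μ ν := by
  have hs' : (0 : ℝ) < s := hs
  have hscaled := abs_integral_sub_integral_le_lipDualDist (μ := μ) (ν := ν)
    (f := fun x => f x / s) (fun x => by
      rw [abs_div, abs_of_pos hs', div_le_one hs']
      exact hf x)
    (LipschitzWith.of_dist_le_mul fun x y => by
      rw [Real.dist_eq, ← sub_div, abs_div, abs_of_pos hs', NNReal.coe_one, one_mul,
        div_le_iff₀' hs']
      exact hfl.dist_le_mul x y)
  rwa [integral_div, integral_div, ← sub_div, abs_div, abs_of_pos hs', div_le_iff₀' hs']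
    at hscaled

theorem WeaklyConverges.of_lipDualDist [OpensMeasurableSpace X] {μs νs : ℕ → Measure X}
    {μ : Measure X} [hμs : ∀ k, IsProbabilityMeasure (μs k)]
    [hνs : ∀ k, IsProbabilityMeasure (νs k)] [hμ : IsProbabilityMeasure μ]
    (hν : WeaklyConverges νs μ)
    (hdist : Tendsto (fun k => lipDualDist (μs k) (νs k)) atTop (𝓝 0)) :
    WeaklyConverges μs μ := by
  let P : ProbabilityMeasure X := ⟨μ, hμ⟩
  let Ps : ℕ → ProbabilityMeasure X := fun k => ⟨μs k, hμs k⟩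
  let Qs : ℕ → ProbabilityMeasure X := fun k => ⟨νs k, hνs k⟩
  have hQs : Tendsto Qs atTop (𝓝 P) :=
    ProbabilityMeasure.tendsto_iff_forall_integral_tendsto.2 hν
  suffices hPs : Tendsto Ps atTop (𝓝 P) from
    ProbabilityMeasure.tendsto_iff_forall_integral_tendsto.1 hPs
  have : Nonempty X := nonempty_of_isProbabilityMeasure μ
  rw [tendsto_iff_forall_lipschitz_integral_tendsto] at hQs ⊢
  intro f hb hl
  obtain ⟨s, hs, hfs, hfl⟩ := exists_abs_le_and_lipschitzWith hb hl
  have hdiff : Tendsto (fun k => ∫ x, f x ∂μs k - ∫ x, f x ∂νs k) atTop (𝓝 0) :=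
    squeeze_zero_norm (fun k => abs_integral_sub_integral_le_mul_lipDualDist hs hfs hfl)
      (by simpa using hdist.const_mul (s : ℝ))
  have hsum := hdiff.add (hQs f hb hl)
  rw [zero_add] at hsum
  exact hsum.congr fun k => sub_add_cancel _ _

end LipDualConvergence

section Stationary

theorem boundedMeasurable_of_boundedContinuousFunction {X : Type*} [TopologicalSpace X]
    [MeasurableSpace X] [OpensMeasurableSpace X] (f : BoundedContinuousFunction X ℝ) :
    BoundedMeasurable f :=
  ⟨f.continuous.measurable, ‖f‖, f.norm_coe_le_norm⟩

variable {H E : Type*} [PseudoMetricSpace H] [MeasurableSpace H] [MeasurableSpace E]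
  {ℓ : Measure E} {F : H × E → H} {X : Set H}

theorem MixesExponentiallyOn.mono {Y : Set H} (hY : MixesExponentiallyOn ℓ F Y) (hXY : X ⊆ Y) :
    MixesExponentiallyOn ℓ F X := by
  obtain ⟨A, κ, hA, hκ0, hκ1, hmix⟩ := hY
  exact ⟨A, κ, hA, hκ0, hκ1, fun μ ν _ _ hμ hν =>
    hmix μ ν (hμ.mono fun _ hx => hXY hx) (hν.mono fun _ hx => hXY hx)⟩

theorem MixesExponentiallyOn.tendsto_lipDualDist (hX : MixesExponentiallyOn ℓ F X)
    {μ ν : Measure H} [IsProbabilityMeasure μ] [IsProbabilityMeasure ν] (hμ : ∀ᵐ x ∂μ, x ∈ X)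
    (hν : ∀ᵐ x ∂ν, x ∈ X) :
    Tendsto (fun k => lipDualDist ((stepLaw ℓ F)^[k] μ) ((stepLaw ℓ F)^[k] ν)) atTop (𝓝 0) := by
  obtain ⟨A, κ, -, hκ0, hκ1, hmix⟩ := hX
  refine squeeze_zero (fun k => ?_) (hmix μ ν hμ hν)
    (by simpa using (tendsto_pow_atTop_nhds_zero_of_lt_one hκ0.le hκ1).const_mul A)
  refine Real.sSup_nonneg ?_
  rintro _ ⟨f, -, -, rfl⟩
  exact abs_nonneg _

variable [BorelSpace H] [IsProbabilityMeasure ℓ]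

theorem weaklyConverges_iterate_stepLaw_of_dirac [T2Space H] (hFm : Measurable F) {μ : Measure H}
    (hdirac : ∀ u, WeaklyConverges (fun k => (stepLaw ℓ F)^[k] (Measure.dirac u)) μ)
    (ν : Measure H) [IsProbabilityMeasure ν] :
    WeaklyConverges (fun k => (stepLaw ℓ F)^[k] ν) μ := by
  intro f
  have hf := boundedMeasurable_of_boundedContinuousFunction f
  have hbound : ∀ k u, ‖(markovOp ℓ F)^[k] f u‖ ≤ ‖f‖ := by
    intro k u
    have := isProbabilityMeasure_iterate_stepLaw (ℓ := ℓ) hFm (Measure.dirac u) k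
    rw [iterate_markovOp_eq_integral hFm hf]
    simpa using norm_integral_le_of_norm_le_const
      (μ := (stepLaw ℓ F)^[k] (Measure.dirac u)) (.of_forall f.norm_coe_le_norm)
  have hlim := tendsto_integral_of_dominated_convergence (μ := ν) (fun _ => ‖f‖)
    (fun k => (hf.iterate_markovOp (ℓ := ℓ) hFm k).measurable.aestronglyMeasurable)
    (integrable_const _) (fun k => .of_forall (hbound k)) (.of_forall fun u => by
      simpa only [iterate_markovOp_eq_integral hFm hf] using hdirac u f)
  rw [integral_const, probReal_univ, one_smul] at hlim
  simpa only [integral_iterate_stepLaw hFm hf] using hlim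

theorem MixesExponentiallyOn.weaklyConverges_iterate_stepLaw (hmix : MixesExponentiallyOn ℓ F X)
    (hFm : Measurable F) {μ ν : Measure H} [IsProbabilityMeasure μ] [IsProbabilityMeasure ν]
    (hfix : RDS.stepLaw ℓ F μ = μ) (hν : ∀ᵐ x ∂ν, x ∈ X) (hμ : ∀ᵐ x ∂μ, x ∈ X) :
    WeaklyConverges (fun k => (RDS.stepLaw ℓ F)^[k] ν) μ := by
  have hprob := isProbabilityMeasure_iterate_stepLaw (ℓ := ℓ) hFm ν
  have hconst : WeaklyConverges (fun _ => μ) μ := fun f => tendsto_const_nhds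
  have hdist := hmix.tendsto_lipDualDist hν hμ
  simp only [Function.iterate_fixed hfix] at hdist
  exact hconst.of_lipDualDist hdist

variable [TopologicalSpace E]

theorem continuous_markovOp (hF : Continuous F) (hFm : Measurable F)
    (f : BoundedContinuousFunction H ℝ) : Continuous (markovOp ℓ F f) :=
  continuous_of_dominated (bound := fun _ => ‖f‖)
    (fun _ => (f.continuous.measurable.comp
      (hFm.comp measurable_prodMk_left)).aestronglyMeasurable)
    (fun _ => .of_forall fun _ => f.norm_coe_le_norm _) (integrable_const _)
    (.of_forall fun _ => by fun_prop)

theorem WeaklyConverges.stepLaw (hF : Continuous F) (hFm : Measurable F) {μs : ℕ → Measure H}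
    {μ : Measure H} [∀ k, IsFiniteMeasure (μs k)] [IsFiniteMeasure μ]
    (h : WeaklyConverges μs μ) :
    WeaklyConverges (fun k => stepLaw ℓ F (μs k)) (stepLaw ℓ F μ) := by
  intro f
  have hf := boundedMeasurable_of_boundedContinuousFunction f
  obtain ⟨a, ha⟩ := (hf.markovOp (ℓ := ℓ) hFm).bounded
  simp only [integral_stepLaw hFm hf]
  exact h (.ofNormedAddCommGroup _ (continuous_markovOp hF hFm f) a ha)

theorem MixesExponentiallyOn.exists_stationary [T2Space H] [SecondCountableTopology H]
    (hmix : MixesExponentiallyOn ℓ F X) (hF : Continuous F) (hFm : Measurable F)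
    (hX : IsCompact X) (hXne : X.Nonempty) {K : Set E} (hK : ∀ᵐ ζ ∂ℓ, ζ ∈ K)
    (hinv : ∀ u ∈ X, ∀ ζ ∈ K, F (u, ζ) ∈ X) :
    ∃ μ : Measure H, IsProbabilityMeasure μ ∧ RDS.stepLaw ℓ F μ = μ ∧ ∀ᵐ x ∂μ, x ∈ X := by
  obtain ⟨u, hu⟩ := hXne
  have hdirac : ∀ᵐ x ∂Measure.dirac u, x ∈ X := (ae_dirac_iff hX.measurableSet).2 hu
  have hprob := isProbabilityMeasure_iterate_stepLaw (ℓ := ℓ) hFm (Measure.dirac u)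
  have := isProbabilityMeasure_stepLaw (ℓ := ℓ) hFm (Measure.dirac u)
  obtain ⟨μ, φ, hμ, hφ, hlim, hμX⟩ := exists_subseq_weaklyConverges_of_isCompact hX
    (ae_mem_iterate_stepLaw hFm hdirac hK hX.measurableSet hinv)
  have := isProbabilityMeasure_stepLaw (ℓ := ℓ) hFm μ
  have hprob_step := fun k => isProbabilityMeasure_stepLaw (ℓ := ℓ) hFm
    ((RDS.stepLaw ℓ F)^[φ k] (Measure.dirac u))
  have hforget : Tendsto (fun k => lipDualDist
      (RDS.stepLaw ℓ F ((RDS.stepLaw ℓ F)^[φ k] (Measure.dirac u)))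
      ((RDS.stepLaw ℓ F)^[φ k] (Measure.dirac u))) atTop (𝓝 0) := by
    simp only [← Function.iterate_succ_apply', Function.iterate_succ_apply]
    exact (hmix.tendsto_lipDualDist (ae_mem_stepLaw hFm hdirac hK hX.measurableSet hinv)
      hdirac).comp hφ.tendsto_atTop
  exact ⟨μ, hμ, (hlim.stepLaw hF hFm).unique (hlim.of_lipDualDist hforget), hμX⟩

end Stationary

section Attraction

variable {H E : Type*} [NormedAddCommGroup H] [MeasurableSpace H] [BorelSpace H]
  [MeasurableSpace E] {ℓ : Measure E} {F : H × E → H}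

theorem eq_of_stepLaw_eq_of_weaklyConverges {μ ν : Measure H} [IsFiniteMeasure μ]
    [IsFiniteMeasure ν] (hfix : stepLaw ℓ F ν = ν)
    (hconv : WeaklyConverges (fun k => (stepLaw ℓ F)^[k] ν) μ) : ν = μ := by
  simp only [Function.iterate_fixed hfix] at hconv
  exact WeaklyConverges.unique (fun f => tendsto_const_nhds) hconv

variable [IsProbabilityMeasure ℓ]

theorem exists_stationary_forall_weaklyConverges [SecondCountableTopology H] [TopologicalSpace E]
    {R : ℝ} (hmix : ∀ R', R ≤ R' → MixesExponentiallyOn ℓ F (Metric.closedBall 0 R'))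
    (hF : Continuous F) (hFm : Measurable F) {X : Set H} (hX : IsCompact X) (hXne : X.Nonempty)
    (hXR : X ⊆ Metric.closedBall 0 R) {K : Set E} (hK : ∀ᵐ ζ ∂ℓ, ζ ∈ K)
    (hinv : ∀ u ∈ X, ∀ ζ ∈ K, F (u, ζ) ∈ X) :
    ∃ μ : Measure H, IsProbabilityMeasure μ ∧ stepLaw ℓ F μ = μ ∧ SupportedByBall μ R ∧
      ∀ ν : Measure H, IsProbabilityMeasure ν →
        WeaklyConverges (fun k => (stepLaw ℓ F)^[k] ν) μ := by
  obtain ⟨μ, hμ, hfix, hμX⟩ :=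
    ((hmix R le_rfl).mono hXR).exists_stationary hF hFm hX hXne hK hinv
  refine ⟨μ, hμ, hfix, mem_ae_iff.1 (hμX.mono fun _ hx => hXR hx), fun ν _ =>
    weaklyConverges_iterate_stepLaw_of_dirac hFm (fun u => ?_) ν⟩
  refine (hmix (max R ‖u‖) (le_max_left _ _)).weaklyConverges_iterate_stepLaw hFm hfix ?_ ?_
  · exact (ae_dirac_iff measurableSet_closedBall).2 (by simp)
  · exact hμX.mono fun _ hx =>
      Metric.closedBall_subset_closedBall (le_max_left _ _) (hXR hx)

end Attraction

section Independence

variable {Ω A B C : Type*} [MeasurableSpace Ω] [MeasurableSpace A] [MeasurableSpace B]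
  [MeasurableSpace C] {Pr : Measure Ω} [IsProbabilityMeasure Pr] {X : Ω → A} {Y : Ω → B}

theorem indepFun_prodMk_of_indepFun {Z : Ω → C} (hX : Measurable X) (hY : Measurable Y)
    (hZ : Measurable Z) (hXYZ : IndepFun X (fun ω => (Y ω, Z ω)) Pr) (hYZ : IndepFun Y Z Pr) :
    IndepFun (fun ω => (X ω, Y ω)) Z Pr := by
  have := Measure.isProbabilityMeasure_map (μ := Pr) hX.aemeasurable
  have := Measure.isProbabilityMeasure_map (μ := Pr) hY.aemeasurable
  have := Measure.isProbabilityMeasure_map (μ := Pr) hZ.aemeasurable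
  have hXY : IndepFun X Y Pr := hXYZ.comp measurable_id measurable_fst
  rw [indepFun_iff_map_prod_eq_prod_map_map hX.aemeasurable (hY.prodMk hZ).aemeasurable,
    (indepFun_iff_map_prod_eq_prod_map_map hY.aemeasurable hZ.aemeasurable).1 hYZ,
    ← Measure.prodAssoc_prod] at hXYZ
  rw [indepFun_iff_map_prod_eq_prod_map_map (hX.prodMk hY).aemeasurable hZ.aemeasurable,
    (indepFun_iff_map_prod_eq_prod_map_map hX.aemeasurable hY.aemeasurable).1 hXY]
  apply MeasurableEquiv.map_measurableEquiv_injective MeasurableEquiv.prodAssoc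
  rw [← hXYZ, Measure.map_map (by fun_prop) (by fun_prop)]
  rfl

theorem setIntegral_prodMk_of_indepFun (hX : Measurable X) (hY : Measurable Y)
    (hXY : IndepFun X Y Pr) {g : A × B → ℝ} (hg : BoundedMeasurable g) {s : Set A}
    (hs : MeasurableSet s) :
    ∫ ω in X ⁻¹' s, g (X ω, Y ω) ∂Pr = ∫ ω in X ⁻¹' s, ∫ ω', g (X ω, Y ω') ∂Pr ∂Pr := by
  have := Measure.isProbabilityMeasure_map (μ := Pr) hX.aemeasurable
  have := Measure.isProbabilityMeasure_map (μ := Pr) hY.aemeasurable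
  have hsection : ∀ x, ∫ y, g (x, y) ∂Pr.map Y = ∫ ω', g (x, Y ω') ∂Pr := fun x =>
    integral_map hY.aemeasurable (hg.measurable.comp measurable_prodMk_left).aestronglyMeasurable
  have hinner : StronglyMeasurable fun x => ∫ y, g (x, y) ∂Pr.map Y :=
    hg.measurable.stronglyMeasurable.integral_prod_right'
  calc ∫ ω in X ⁻¹' s, g (X ω, Y ω) ∂Pr
      = ∫ p in s ×ˢ Set.univ, g p ∂(Pr.map fun ω => (X ω, Y ω)) := by
        rw [setIntegral_map (hs.prod .univ) hg.measurable.aestronglyMeasurable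
          (hX.prodMk hY).aemeasurable]
        simp only [Set.mk_preimage_prod, Set.preimage_univ, Set.inter_univ]
    _ = ∫ x in s, ∫ y, g (x, y) ∂Pr.map Y ∂Pr.map X := by
        rw [(indepFun_iff_map_prod_eq_prod_map_map hX.aemeasurable hY.aemeasurable).1 hXY,
          setIntegral_prod _ (hg.integrable _).integrableOn]
        simp only [Measure.restrict_univ]
    _ = ∫ ω in X ⁻¹' s, ∫ ω', g (X ω, Y ω') ∂Pr ∂Pr := by
        rw [setIntegral_map hs hinner.aestronglyMeasurable hX.aemeasurable]
        simp only [hsection]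

theorem condExp_prodMk_of_indepFun (hX : Measurable X) (hY : Measurable Y)
    (hXY : IndepFun X Y Pr) {g : A × B → ℝ} (hg : BoundedMeasurable g) :
    Pr[fun ω => g (X ω, Y ω) | MeasurableSpace.comap X inferInstance]
      =ᵐ[Pr] fun ω => ∫ ω', g (X ω, Y ω') ∂Pr := by
  obtain ⟨C, hC⟩ := hg.bounded
  have hgY : Measurable fun p : A × Ω => g (p.1, Y p.2) :=
    hg.measurable.comp (measurable_fst.prodMk (hY.comp measurable_snd))
  have hinner : StronglyMeasurable fun x => ∫ ω', g (x, Y ω') ∂Pr :=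
    hgY.stronglyMeasurable.integral_prod_right'
  have hbound : ∀ x, ‖∫ ω', g (x, Y ω') ∂Pr‖ ≤ C := fun x => by
    simpa using norm_integral_le_of_norm_le_const (μ := Pr) (f := fun ω' => g (x, Y ω'))
      (.of_forall fun ω' => hC (x, Y ω'))
  refine (ae_eq_condExp_of_forall_setIntegral_eq hX.comap_le
    ((hg.comp (hX.prodMk hY)).integrable Pr) (fun s _ _ => ?_) ?_
    (hinner.comp_measurable (comap_measurable X)).aestronglyMeasurable).symm
  · exact (Integrable.of_bound (hinner.comp_measurable hX).aestronglyMeasurable C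
      (.of_forall fun ω => hbound (X ω))).integrableOn
  · rintro _ ⟨s, hs, rfl⟩ _
    exact (setIntegral_prodMk_of_indepFun hX hY hXY hg hs).symm

end Independence

section Noise

variable {Ω H E : Type*} [MeasurableSpace Ω] [MeasurableSpace H] [MeasurableSpace E]
  {Pr : Measure Ω} {η : ℕ → Ω → E} {ℓ : Measure E}

theorem IsIIDWithLaw.shift (hη : IsIIDWithLaw Pr η ℓ) (k : ℕ) :
    IsIIDWithLaw Pr (fun j => η (k + j)) ℓ :=
  ⟨fun _ => hη.measurable _, hη.indep.precomp (add_right_injective k), fun _ => hη.law _⟩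

theorem IsIIDWithLaw.measurable_seq (hη : IsIIDWithLaw Pr η ℓ) : Measurable fun ω k => η k ω :=
  measurable_pi_iff.2 hη.measurable

theorem IsIIDWithLaw.indepFun_tail (hη : IsIIDWithLaw Pr η ℓ) :
    IndepFun (η 0) (fun ω j => η (1 + j) ω) Pr := by
  have hdisj : Disjoint (Set.range fun _ : Unit => 0) (Set.range fun j => 1 + j) := by
    rw [Set.disjoint_left]
    rintro _ ⟨_, rfl⟩ ⟨j, hj⟩
    simp at hj
  exact (indepFun_subfamilies hη.measurable hη.indep hdisj).comp
    (φ := fun y : Unit → E => y ()) (measurable_pi_apply ()) measurable_id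

variable [IsProbabilityMeasure Pr]

theorem IsIIDWithLaw.isProbabilityMeasure (hη : IsIIDWithLaw Pr η ℓ) : IsProbabilityMeasure ℓ := by
  rw [← hη.law 0]
  exact Measure.isProbabilityMeasure_map (hη.measurable 0).aemeasurable

theorem IsIIDWithLaw.comp_snd (hη : IsIIDWithLaw Pr η ℓ) (μ : Measure H)
    [IsProbabilityMeasure μ] : IsIIDWithLaw (μ.prod Pr) (fun k p => η k p.2) ℓ := by
  have hsnd : (μ.prod Pr).map Prod.snd = Pr := by simp
  have hlaw : ∀ k, (μ.prod Pr).map (fun p => η k p.2) = Pr.map (η k) := fun k =>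
    (Measure.map_map (hη.measurable k) measurable_snd).symm.trans (by rw [hsnd])
  have hmeas : ∀ k, Measurable fun p : H × Ω => η k p.2 := fun k =>
    (hη.measurable k).comp measurable_snd
  refine ⟨hmeas, ?_, fun k => (hlaw k).trans (hη.law k)⟩
  rw [iIndepFun_iff_map_fun_eq_infinitePi_map hmeas]
  simp only [hlaw]
  rw [← hη.indep.map_fun_eq_infinitePi_map hη.measurable, ← hsnd,
    Measure.map_map hη.measurable_seq measurable_snd, hsnd]
  rfl

end Noise

section Trajectory

variable {Ω Ω' H E : Type*} {F : H × E → H} {η : ℕ → Ω → E} {v : Ω → H}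

theorem trajectory_comp (φ : Ω' → Ω) (k : ℕ) :
    trajectory F η v k ∘ φ = trajectory F (fun j => η j ∘ φ) (v ∘ φ) k := by
  induction k with
  | zero => rfl
  | succ k ih => simp only [trajectory, ← ih]; rfl

theorem trajectory_add (k n : ℕ) : trajectory F η v (k + n) =
    trajectory F (fun j => η (k + j)) (trajectory F η v k) n := by
  induction n with
  | zero => rfl
  | succ n ih =>
    rw [← add_assoc]
    simp only [trajectory, ih]

variable [MeasurableSpace Ω] [MeasurableSpace H] [MeasurableSpace E] {Pr : Measure Ω}
  {ℓ : Measure E}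

theorem measurable_trajectory (hF : Measurable F) (hη : ∀ k, Measurable (η k))
    (hv : Measurable v) (k : ℕ) : Measurable (trajectory F η v k) := by
  induction k with
  | zero => exact hv
  | succ k ih => exact hF.comp (ih.prodMk (hη k))

theorem measurable_history (hF : Measurable F) (hη : ∀ k, Measurable (η k)) (hv : Measurable v)
    (k : ℕ) : Measurable fun ω (j : Fin (k + 1)) => trajectory F η v j ω :=
  measurable_pi_iff.2 fun j => measurable_trajectory hF hη hv j

variable [IsProbabilityMeasure Pr]

theorem indepFun_history (hF : Measurable F) (hη : IsIIDWithLaw Pr η ℓ) (hv : Measurable v)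
    (hind : IndepFun v (fun ω k => η k ω) Pr) (k : ℕ) :
    IndepFun (fun ω (j : Fin (k + 1)) => trajectory F η v j ω) (fun ω j => η (k + j) ω) Pr := by
  induction k with
  | zero =>
    simp only [zero_add, Fin.val_eq_zero]
    exact hind.comp (φ := fun x (_ : Fin 1) => x) (by fun_prop) measurable_id
  | succ k ih =>
    have hsplit : IndepFun (fun ω (j : Fin (k + 1)) => trajectory F η v j ω)
        (fun ω => (η k ω, fun j => η (k + (1 + j)) ω)) Pr :=
      ih.comp (φ := id) (ψ := fun y : ℕ → E => (y 0, fun j => y (1 + j))) measurable_id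
        (by fun_prop)
    have hjoint := indepFun_prodMk_of_indepFun (measurable_history hF hη.measurable hv k)
      (hη.measurable k) ((hη.shift k).shift 1).measurable_seq hsplit (hη.shift k).indepFun_tail
    have hsnoc : Measurable fun p : (Fin (k + 1) → H) × E =>
        (Fin.snoc p.1 (F (p.1 (Fin.last k), p.2)) : Fin (k + 2) → H) := by
      refine measurable_pi_iff.2 fun j => ?_
      induction j using Fin.lastCases with
      | last => simp only [Fin.snoc_last]; fun_prop
      | cast j => simp only [Fin.snoc_castSucc]; fun_prop
    convert IndepFun.comp hjoint hsnoc measurable_id using 1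
    · funext ω j
      induction j using Fin.lastCases with
      | last => simp [trajectory]
      | cast j => simp
    · simp only [add_assoc]
      rfl

theorem indepFun_trajectory (hF : Measurable F) (hη : IsIIDWithLaw Pr η ℓ) (hv : Measurable v)
    (hind : IndepFun v (fun ω k => η k ω) Pr) (k : ℕ) :
    IndepFun (trajectory F η v k) (η k) Pr :=
  (indepFun_history hF hη hv hind k).comp (φ := fun x : Fin (k + 1) → H => x (Fin.last k))
    (ψ := fun y : ℕ → E => y 0) (by fun_prop) (by fun_prop)

theorem map_trajectory (hF : Measurable F) (hη : IsIIDWithLaw Pr η ℓ) (hv : Measurable v)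
    (hind : IndepFun v (fun ω k => η k ω) Pr) (k : ℕ) :
    Pr.map (trajectory F η v k) = (stepLaw ℓ F)^[k] (Pr.map v) := by
  induction k with
  | zero => rfl
  | succ k ih =>
    have htraj := measurable_trajectory hF hη.measurable hv k
    have := hη.isProbabilityMeasure
    have := Measure.isProbabilityMeasure_map (μ := Pr) htraj.aemeasurable
    rw [Function.iterate_succ_apply', ← ih, stepLaw, ← hη.law k,
      ← (indepFun_iff_map_prod_eq_prod_map_map htraj.aemeasurable
        (hη.measurable k).aemeasurable).1 (indepFun_trajectory hF hη hv hind k),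
      Measure.map_map hF (htraj.prodMk (hη.measurable k))]
    rfl

theorem evolve_eq_iterate_stepLaw (hF : Measurable F) (hη : IsIIDWithLaw Pr η ℓ) (k : ℕ)
    (μ : Measure H) [IsProbabilityMeasure μ] : evolve Pr F η k μ = (stepLaw ℓ F)^[k] μ := by
  have hind : IndepFun (Prod.fst : H × Ω → H) (fun p k => η k p.2) (μ.prod Pr) :=
    indepFun_prod measurable_id hη.measurable_seq
  rw [evolve, map_trajectory hF (hη.comp_snd μ) measurable_fst hind, Measure.map_fst_prod,
    measure_univ, one_smul]

theorem transition_eq_iterate_stepLaw (hF : Measurable F) (hη : IsIIDWithLaw Pr η ℓ) (k : ℕ)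
    (u : H) : transition Pr F η k u = (stepLaw ℓ F)^[k] (Measure.dirac u) := by
  rw [transition, map_trajectory hF hη measurable_const (indepFun_const_left u _),
    Measure.map_const, measure_univ, one_smul]

theorem measurable_transition (hF : Measurable F) (hη : ∀ k, Measurable (η k)) (k : ℕ) :
    Measurable (transition Pr F η k) := by
  have hjoint := measurable_trajectory hF (fun k => (hη k).comp measurable_snd)
    (measurable_fst : Measurable (Prod.fst : H × Ω → H)) k
  have heq : transition Pr F η k = fun u => (Pr.map (Prod.mk u)).map
      (trajectory F (fun j => η j ∘ Prod.snd) Prod.fst k) := funext fun u => by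
    rw [Measure.map_map hjoint measurable_prodMk_left, trajectory_comp]
    rfl
  rw [heq]
  exact (Measure.measurable_map _ hjoint).comp Measurable.map_prodMk_left

theorem transition_shift (hF : Measurable F) (hη : IsIIDWithLaw Pr η ℓ) (k n : ℕ) :
    transition Pr F (fun j => η (k + j)) n = transition Pr F η n := by
  funext u
  rw [transition_eq_iterate_stepLaw hF hη, transition_eq_iterate_stepLaw hF (hη.shift k)]

theorem condExp_trajectory_add (hF : Measurable F) (hη : IsIIDWithLaw Pr η ℓ)
    (hv : Measurable v) (hind : IndepFun v (fun ω k => η k ω) Pr) (k n : ℕ) {f : H → ℝ}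
    (hf : BoundedMeasurable f) :
    Pr[fun ω => f (trajectory F η v (k + n) ω) |
        MeasurableSpace.comap (fun ω (j : Fin (k + 1)) => trajectory F η v j ω) inferInstance]
      =ᵐ[Pr] fun ω => ∫ u, f u ∂transition Pr F η n (trajectory F η v k ω) := by
  let flow : (Fin (k + 1) → H) × (ℕ → E) → H :=
    trajectory F (fun j p => p.2 j) (fun p => p.1 (Fin.last k)) n
  have hflow : Measurable flow :=
    measurable_trajectory hF (fun j => by fun_prop) (by fun_prop) n
  have hflow_apply : ∀ x : Ω → Fin (k + 1) → H, (fun ω => flow (x ω, fun j => η (k + j) ω)) =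
      trajectory F (fun j => η (k + j)) (fun ω => x ω (Fin.last k)) n := fun x =>
    trajectory_comp (η := fun j p => p.2 j)
      (v := fun p : (Fin (k + 1) → H) × (ℕ → E) => p.1 (Fin.last k))
      (fun ω => (x ω, fun j => η (k + j) ω)) n
  have hbefore : trajectory F η v (k + n) =
      fun ω => flow (fun j => trajectory F η v j ω, fun j => η (k + j) ω) :=
    (trajectory_add k n).trans (hflow_apply fun ω j => trajectory F η v j ω).symm
  have hafter : ∀ ω, ∫ u, f u ∂transition Pr F η n (trajectory F η v k ω) =
      ∫ ω', f (flow (fun j => trajectory F η v j ω, fun j => η (k + j) ω')) ∂Pr := fun ω => by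
    rw [← transition_shift hF hη k, transition, integral_map (measurable_trajectory hF
      (hη.shift k).measurable measurable_const n).aemeasurable hf.measurable.aestronglyMeasurable]
    exact congrArg (fun T : Ω → H => ∫ ω', f (T ω') ∂Pr)
      (hflow_apply fun _ j => trajectory F η v j ω).symm
  simp only [hbefore, hafter]
  exact condExp_prodMk_of_indepFun (measurable_history hF hη.measurable hv k)
    (hη.shift k).measurable_seq (indepFun_history hF hη hv hind k) (hf.comp hflow)

theorem isMarkovChain_trajectory (hF : Measurable F) (hη : IsIIDWithLaw Pr η ℓ)
    (hv : Measurable v) (hind : IndepFun v (fun ω k => η k ω) Pr) :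
    IsMarkovChain Pr (trajectory F η v) (transition Pr F η) where
  measurable := measurable_trajectory hF hη.measurable hv
  measurable_transition := measurable_transition hF hη.measurable
  isProbabilityMeasure n u := Measure.isProbabilityMeasure_map
    (measurable_trajectory hF hη.measurable measurable_const n).aemeasurable
  markov k n A hA := by
    have hindicator : BoundedMeasurable (A.indicator (1 : H → ℝ)) :=
      ⟨measurable_one.indicator hA, 1, fun u => by
        rw [← Real.norm_eq_abs]
        exact (norm_indicator_le_norm_self _ _).trans norm_one.le⟩
    have hhistory : ⨆ j : Fin (k + 1), MeasurableSpace.comap (trajectory F η v j) inferInstance =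
        MeasurableSpace.comap (fun ω (j : Fin (k + 1)) => trajectory F η v j ω)
          MeasurableSpace.pi := by
      simp only [MeasurableSpace.pi, MeasurableSpace.comap_iSup, MeasurableSpace.comap_comp]
      rfl
    have hmarkov := condExp_trajectory_add hF hη hv hind k n hindicator
    simp only [integral_indicator_one hA] at hmarkov
    rw [hhistory]
    exact hmarkov

end Trajectory

end RDS

theorem mainTheorem1_general
    {H E V Ω ι : Type*}
    [NormedAddCommGroup H] [InnerProductSpace ℝ H]
    [TopologicalSpace.SeparableSpace H] [MeasurableSpace H] [BorelSpace H]
    [NormedAddCommGroup E] [InnerProductSpace ℝ E]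
    [TopologicalSpace.SeparableSpace E] [MeasurableSpace E] [BorelSpace E]
    [NormedAddCommGroup V] [NormedSpace ℝ V]
    [MeasurableSpace Ω] (Pr : Measure Ω) [IsProbabilityMeasure Pr] [Countable ι]
    (emb : V →L[ℝ] H) (hemb : IsCompactOperator emb)
    (S : H × E → V) (η : ℕ → Ω → E) (ℓ : Measure E) (hη : RDS.IsIIDWithLaw Pr η ℓ)
    (F : H × E → H) (hF : F = fun z => emb (S z)) (γ β : ℝ)
    (hA1 : RDS.Regular S)
    (hH1 : RDS.Decomposable ι Pr η)
    (hH2 : RDS.Dissipative F ℓ.support γ β)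
    (hH3 : RDS.NonDegenerate emb S ℓ.support) :
    (∀ v : Ω → H, Measurable v → IndepFun v (fun ω k => η k ω) Pr →
      RDS.IsMarkovChain Pr (RDS.trajectory F η v) (RDS.transition Pr F η) ∧
      ∀ k, Pr.map (RDS.trajectory F η v k) = RDS.evolve Pr F η k (Pr.map v)) ∧
    ∃ μstar : Measure H, IsProbabilityMeasure μstar ∧
      (∀ k, RDS.evolve Pr F η k μstar = μstar) ∧
      (∀ μ : Measure H, IsProbabilityMeasure μ → RDS.evolve Pr F η 1 μ = μ → μ = μstar) ∧
      RDS.SupportedByBall μstar (β / (1 - γ)) ∧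
      (∀ R : ℝ, β / (1 - γ) ≤ R → ∃ C κ : ℝ, 0 < C ∧ 0 < κ ∧ κ < 1 ∧
        ∀ μ : Measure H, IsProbabilityMeasure μ → RDS.SupportedByBall μ R →
          ∀ k : ℕ, 1 ≤ k → RDS.lipDualDist (RDS.evolve Pr F η k μ) μstar ≤ C * κ ^ k) ∧
      (∀ ν : Measure H, IsProbabilityMeasure ν →
        RDS.WeaklyConverges (fun k => RDS.evolve Pr F η k ν) μstar) := by
  subst hF
  have := UniformSpace.secondCountable_of_separable H
  have := UniformSpace.secondCountable_of_separable E
  have := hη.isProbabilityMeasure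
  have hcont : Continuous fun z => emb (S z) := emb.continuous.comp hA1.contDiff.continuous
  have hm := hcont.measurable
  obtain ⟨e, hs, hK, h0⟩ := hH1.shearStable_and_support hη
  have hℓK : ∀ᵐ ζ ∂ℓ, ζ ∈ ℓ.support := Measure.support_mem_ae
  have hmix := fun R (hR : β / (1 - γ) ≤ R) => hH3.mixesExponentiallyOn_closedBall e.orthonormal
    (Submodule.dense_iff_topologicalClosure_eq_top.2 e.dense_span) hemb hA1 hm hs hK hℓK h0 hH2 hR
  obtain ⟨X, hX, hXR, hRX⟩ := hH2.exists_isCompact hemb hA1 hK.isBounded le_rfl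
  have hR₀ : 0 ≤ β / (1 - γ) := (div_pos hH2.beta_pos (sub_pos.2 hH2.gamma_lt_one)).le
  obtain ⟨μstar, hμstar, hfix, hball, hconv⟩ := RDS.exists_stationary_forall_weaklyConverges hmix
    hcont hm hX ⟨_, hRX 0 (Metric.mem_closedBall_self hR₀) 0 h0⟩ hXR hℓK
    fun u hu => hRX u (hXR hu)
  have hevolve := RDS.evolve_eq_iterate_stepLaw hm hη
  refine ⟨fun v hv hind => ⟨RDS.isMarkovChain_trajectory hm hη hv hind, fun k => ?_⟩, μstar,
    hμstar, fun k => ?_, fun μ hμ hμfix => ?_, hball, fun R hR => ?_, fun ν hν => ?_⟩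
  · have := Measure.isProbabilityMeasure_map (μ := Pr) hv.aemeasurable
    rw [RDS.map_trajectory hm hη hv hind, hevolve]
  · rw [hevolve, Function.iterate_fixed hfix]
  · exact RDS.eq_of_stepLaw_eq_of_weaklyConverges ((hevolve 1 μ).symm.trans hμfix) (hconv μ hμ)
  · obtain ⟨C, κ, hC, hκ0, hκ1, hCκ⟩ := hmix R hR
    refine ⟨C, κ, hC, hκ0, hκ1, fun μ _ hμR k _ => ?_⟩
    have hμstarR : RDS.SupportedByBall μstar R :=
      measure_mono_null (Set.compl_subset_compl.2 (Metric.closedBall_subset_closedBall hR)) hball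
    have hdist := hCκ μ μstar (mem_ae_iff.2 hμR) (mem_ae_iff.2 hμstarR) k
    rwa [Function.iterate_fixed hfix, ← hevolve] at hdist
  · simpa only [hevolve] using hconv ν hν

theorem mainTheorem1
    {H E V Ω ι : Type*}
    [NormedAddCommGroup H] [InnerProductSpace ℝ H] [CompleteSpace H]
    [TopologicalSpace.SeparableSpace H] [MeasurableSpace H] [BorelSpace H]
    [NormedAddCommGroup E] [InnerProductSpace ℝ E] [CompleteSpace E]
    [TopologicalSpace.SeparableSpace E] [MeasurableSpace E] [BorelSpace E]
    [NormedAddCommGroup V] [NormedSpace ℝ V] [CompleteSpace V]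
    [MeasurableSpace Ω] (Pr : Measure Ω) [IsProbabilityMeasure Pr] [Countable ι]
    (emb : V →L[ℝ] H) (hemb : RDS.IsCompactDenseEmbedding emb)
    (S : H × E → V) (η : ℕ → Ω → E) (ℓ : Measure E) (hη : RDS.IsIIDWithLaw Pr η ℓ)
    (F : H × E → H) (hF : F = fun z => emb (S z)) (γ β : ℝ)
    (hA1 : RDS.Regular S)
    (hH1 : RDS.Decomposable ι Pr η)
    (hH2 : RDS.Dissipative F ℓ.support γ β)
    (hH3 : RDS.NonDegenerate emb S ℓ.support) :
    -- the equation defines a Markov chain, and its laws are given by `P_k^*`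
    (∀ v : Ω → H, Measurable v → IndepFun v (fun ω k => η k ω) Pr →
      RDS.IsMarkovChain Pr (RDS.trajectory F η v) (RDS.transition Pr F η) ∧
      ∀ k, Pr.map (RDS.trajectory F η v k) = RDS.evolve Pr F η k (Pr.map v)) ∧
    ∃ μstar : Measure H, IsProbabilityMeasure μstar ∧
      -- `μstar` is stationary, and it is the only stationary probability measure
      (∀ k, RDS.evolve Pr F η k μstar = μstar) ∧
      (∀ μ : Measure H, IsProbabilityMeasure μ → RDS.evolve Pr F η 1 μ = μ → μ = μstar) ∧
      RDS.SupportedByBall μstar (β / (1 - γ)) ∧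
      -- exponential mixing for initial laws supported by a ball
      (∀ R : ℝ, β / (1 - γ) ≤ R → ∃ C κ : ℝ, 0 < C ∧ 0 < κ ∧ κ < 1 ∧
        ∀ μ : Measure H, IsProbabilityMeasure μ → RDS.SupportedByBall μ R →
          ∀ k : ℕ, 1 ≤ k → RDS.lipDualDist (RDS.evolve Pr F η k μ) μstar ≤ C * κ ^ k) ∧
      -- weak convergence for arbitrary initial laws
      (∀ ν : Measure H, IsProbabilityMeasure ν →
        RDS.WeaklyConverges (fun k => RDS.evolve Pr F η k ν) μstar) :=
  mainTheorem1_general Pr emb hemb.compact S η ℓ hη F hF γ β hA1 hH1 hH2 hH3
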